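/- There are no regular $\Theta$-shrinkers. More precisely, a regular $\Theta$-shrinker is a set $N\subset\mathbb R^2$ of the form $$N=\gamma_1([0,L_1])\cup\gamma_2([0,L_2])\cup\gamma_3([0,L_3]),\qquad L_i>0,$$ where there are two points $A\neq B$ (the triple junctions) such that: 1. each $\gamma_i:[0,L_i]\to\mathbb R^2$ is an injective curve of class $C^2$ (up to the endpoints), parametrized by arclength, with $\gamma_i(0)=A$ and $\gamma_i(L_i)=B$; 2. for $i\ne j$ the arcs $\gamma_i([0,L_i])$ and $\gamma_j([0,L_j])$ intersect only at $A$ and $B$; 3. at each of the points $A$ and $B$ the tangent vectors of the three curves form angles of $120$ degrees with one another, i.e. for $i\neq j$ the angle between $\gamma_i'(0)$ and $\gamma_j'(0)$ and the angle between $\gamma_i'(L_i)$ and $\gamma_j'(L_j)$ are equal to $2\pi/3$; 4. each $\gamma=\gamma_i$ satisfies the shrinker equation $$k+\langle\gamma\,|\,\nu\rangle=0\qquad\text{on }[0,L_i],$$ where $\tau=\frac{d\gamma}{ds}$ is the unit tangent, $\nu$ is the counterclockwise rotation of $\tau$ by $\pi/2$, and the curvature $k$ is defined by $\frac{d^2\gamma}{ds^2}=k\,\nu$.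 No set $N\subset\mathbb R^2$ with these properties exists. -/

import Mathlib

open Set

noncomputable section

namespace ThetaShrinker

/-- The Euclidean plane. -/
abbrev Plane : Type := EuclideanSpace ℝ (Fin 2)

/-- Counterclockwise rotation by 90 degrees. -/
def rot90 (v : Plane) : Plane := !₂[-v 1, v 0]

/-- The tangent vector `τ = dγ/ds` of a curve `γ` on `[0, L]` (one-sided at the endpoints). -/
def tangent (γ : ℝ → Plane) (L s : ℝ) : Plane := derivWithin γ (Icc 0 L) s

/-- The normal vector `ν`: the counterclockwise rotation by 90 degrees of the tangent. -/
def normal (γ : ℝ → Plane) (L s : ℝ) : Plane := rot90 (tangent γ L s)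

/-- The curvature vector `d²γ/ds²` of a curve `γ` parametrized by arclength on `[0, L]`. -/
def curvatureVector (γ : ℝ → Plane) (L s : ℝ) : Plane :=
  derivWithin (tangent γ L) (Icc 0 L) s

/-- The curvature `k` of a curve parametrized by arclength, determined by `d²γ/ds² = k ν`
(for such a curve `d²γ/ds²` is orthogonal to `τ`). -/
def curvature (γ : ℝ → Plane) (L s : ℝ) : ℝ :=
  inner ℝ (curvatureVector γ L s) (normal γ L s)

/-- An embedded shrinking arc of length `L`: an injective `C²` curve on `[0, L]`, parametrized by
arclength, that satisfies `k + ⟨γ | ν⟩ = 0`. -/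
structure IsShrinkingArc (γ : ℝ → Plane) (L : ℝ) : Prop where
  length_pos : 0 < L
  contDiffOn : ContDiffOn ℝ 2 γ (Icc 0 L)
  injOn : InjOn γ (Icc 0 L)
  arclength : ∀ s ∈ Icc 0 L, ‖tangent γ L s‖ = 1
  shrinker : ∀ s ∈ Icc 0 L, curvature γ L s + inner ℝ (γ s) (normal γ L s) = 0

/-- Three embedded shrinking arcs, oriented from `A` to `B`, which meet each other only at `A` and
`B` and form angles of 120 degrees at both of these points. -/
structure IsRegularThetaTriple (γ : Fin 3 → ℝ → Plane) (L : Fin 3 → ℝ) (A B : Plane) :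
    Prop where
  arc : ∀ i, IsShrinkingArc (γ i) (L i)
  left_end : ∀ i, γ i 0 = A
  right_end : ∀ i, γ i (L i) = B
  inter : ∀ i j, i ≠ j → γ i '' Icc 0 (L i) ∩ γ j '' Icc 0 (L j) = {A, B}
  angle_left : ∀ i j, i ≠ j →
    InnerProductGeometry.angle (tangent (γ i) (L i) 0) (tangent (γ j) (L j) 0)
      = 2 * Real.pi / 3
  angle_right : ∀ i j, i ≠ j →
    InnerProductGeometry.angle (tangent (γ i) (L i) (L i)) (tangent (γ j) (L j) (L j))
      = 2 * Real.pi / 3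

/-- A subset of the plane is a regular `Θ`-shrinker if it is the union of three arcs as above.
The two triple junctions are distinct because each arc is injective and has positive length. -/
def IsRegularThetaShrinker (N : Set Plane) : Prop :=
  ∃ (A B : Plane) (L : Fin 3 → ℝ) (γ : Fin 3 → ℝ → Plane),
    IsRegularThetaTriple γ L A B ∧ N = ⋃ i, γ i '' Icc 0 (L i)

end ThetaShrinker

end

/-! ### Shrinking arcs in polar coordinates: equations, first integral, monotonicity. -/

namespace ThetaShrinker
open Real

/-! Let `r` be the distance to the origin. Along a shrinking arc `k * exp (-r² / 2)` is constant, so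
either `k` vanishes identically and the arc lies on a line through the origin, or `k` has a fixed
sign and the arc is a graph over the polar angle, run counterclockwise or clockwise. The unit
tangents at `A` sum to zero, hence so do the three curvatures there. Up to reflection and
relabelling their signs are `+ + -`, `+ - 0` or `0 0 0`; the last case forces `A = B = 0`. By
embeddedness, two arcs of opposite directions sweep together exactly `2π` (`add_eq_two_pi`).

The rest is a study of how far the tangent turns. With the tangent angle as parameter and `u = ⟨γ |
τ⟩` one has `k' = u` and `u' = 1/k - k`. Sturm comparison for products of `u` with a function of `k`
bounds the turning between a point and a neighbouring extremum of `r`; in particular an arc with `ξ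
≥ π / 6` turns by less than `2π / 3` before its next maximum of `r` (`angle_to_top_lt`). Conversely
a minimum and the next maximum are more than `π / 2` apart in polar angle (`pi_div_two_lt`).

Case `+ - 0`: the curved arc with positive curvature spans the polar angle `π` and turns by exactly
`4π / 3`. With one maximum it would turn by less; further extrema need more room than `π`.

Case `+ + -`: an outer arc `p` and an inner arc `m` run over the same polar angle `Φ`, and a third
arc `q` over `2π - Φ`. The tangent of `p` turns by more than `4π / 3`, so `p` has two maxima with a
minimum between them and `Φ > π`. Comparing first integrals at that minimum shows that `m` has a
single extremum, a minimum, and then that both junctions lie outside the unit circle (`left_pos`).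
The turnings of `m` and `q` add up to `4π / 3`, but the Sturm bounds, compared at the junctions by
`lt_arctan_slope_sub`, leave strictly less. -/

/-- A shrinking arc in polar form: `ρ` is the logarithm of the distance to the origin and `ξ` the
angle between the tangent and the direction of increasing polar angle, as functions of the polar
angle. -/
structure PolarArc (ρ ξ : ℝ → ℝ) (a b : ℝ) : Prop where
  contRho : ContinuousOn ρ (Icc a b)
  contXi : ContinuousOn ξ (Icc a b)
  derivRho : ∀ t ∈ Ioo a b, HasDerivAt ρ (tan (ξ t)) t
  derivXi : ∀ t ∈ Ioo a b, HasDerivAt ξ (1 - exp (2 * ρ t)) t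
  bound : ∀ t ∈ Icc a b, ξ t ∈ Ioo (-(π / 2)) (π / 2)

namespace PolarArc

variable {ρ ξ : ℝ → ℝ} {a b : ℝ}

theorem sub (h : PolarArc ρ ξ a b) {a' b' : ℝ} (ha : a ≤ a') (hb : b' ≤ b) :
    PolarArc ρ ξ a' b' where
  contRho := h.contRho.mono (Icc_subset_Icc ha hb)
  contXi := h.contXi.mono (Icc_subset_Icc ha hb)
  derivRho t ht := h.derivRho t (Ioo_subset_Ioo ha hb ht)
  derivXi t ht := h.derivXi t (Ioo_subset_Ioo ha hb ht)
  bound t ht := h.bound t (Icc_subset_Icc ha hb ht)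

/-- Reflection of an arc, which exchanges its endpoints. -/
theorem reflect (h : PolarArc ρ ξ a b) (c : ℝ) :
    PolarArc (fun t => ρ (c - t)) (fun t => -ξ (c - t)) (c - b) (c - a) where
  contRho := h.contRho.comp (by fun_prop) (fun t ht => ⟨by linarith [ht.2], by linarith [ht.1]⟩)
  contXi := (h.contXi.comp (f := fun t => c - t) (by fun_prop)
    (fun t ht => ⟨by linarith [ht.2], by linarith [ht.1]⟩)).neg
  derivRho t ht := by
    have h1 := h.derivRho (c - t) ⟨by linarith [ht.2], by linarith [ht.1]⟩
    have h2 := h1.comp t ((hasDerivAt_id t).const_sub c)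
    simpa [Function.comp_def] using h2
  derivXi t ht := by
    have h1 := h.derivXi (c - t) ⟨by linarith [ht.2], by linarith [ht.1]⟩
    exact (h1.comp t ((hasDerivAt_id t).const_sub c)).neg.congr_deriv (by simp)
  bound t ht := by
    have h1 := h.bound (c - t) ⟨by linarith [ht.2], by linarith [ht.1]⟩
    exact ⟨by linarith [h1.2], by linarith [h1.1]⟩

theorem cos_pos (h : PolarArc ρ ξ a b) {t : ℝ} (ht : t ∈ Icc a b) : 0 < cos (ξ t) :=
  cos_pos_of_mem_Ioo (h.bound t ht)

/-- Here `k = exp ρ * cos ξ` is the curvature, `u = exp ρ * sin ξ` the tangential component of the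
position, and `t - ξ` the tangent angle up to a constant. The factor `exp (ρ t) ^ 2` is the speed of
that angle, so this formula and the next read `k' = u`, `u' = 1/k - k` with respect to it. -/
theorem derivCos (h : PolarArc ρ ξ a b) {t : ℝ} (ht : t ∈ Ioo a b) :
    HasDerivAt (fun t => exp (ρ t) * cos (ξ t))
      (exp (ρ t) ^ 2 * (exp (ρ t) * sin (ξ t))) t := by
  have h1 := (h.derivRho t ht).exp.mul (h.derivXi t ht).cos
  have hc := (h.cos_pos (Ioo_subset_Icc_self ht)).ne'
  refine h1.congr_deriv ?_
  rw [show exp (2 * ρ t) = exp (ρ t) ^ 2 by rw [← exp_nat_mul]; norm_num, tan_eq_sin_div_cos]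
  field_simp
  ring

theorem derivSin (h : PolarArc ρ ξ a b) {t : ℝ} (ht : t ∈ Ioo a b) :
    HasDerivAt (fun t => exp (ρ t) * sin (ξ t))
      (exp (ρ t) ^ 2 * ((exp (ρ t) * cos (ξ t))⁻¹ - exp (ρ t) * cos (ξ t))) t := by
  have h1 := (h.derivRho t ht).exp.mul (h.derivXi t ht).sin
  have hc := (h.cos_pos (Ioo_subset_Icc_self ht)).ne'
  refine h1.congr_deriv ?_
  rw [show exp (2 * ρ t) = exp (ρ t) ^ 2 by rw [← exp_nat_mul]; norm_num, tan_eq_sin_div_cos]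
  have he := (exp_pos (ρ t)).ne'
  have := sin_sq_add_cos_sq (ξ t)
  field_simp
  linear_combination this

theorem derivAngle (h : PolarArc ρ ξ a b) {t : ℝ} (ht : t ∈ Ioo a b) :
    HasDerivAt (fun t => t - ξ t) (exp (ρ t) ^ 2) t := by
  refine ((hasDerivAt_id t).sub (h.derivXi t ht)).congr_deriv ?_
  rw [show exp (2 * ρ t) = exp (ρ t) ^ 2 by rw [← exp_nat_mul]; norm_num]
  ring

/-- Conservation of `log |k| - r² / 2`. -/
theorem conserved (h : PolarArc ρ ξ a b) {s t : ℝ} (hs : s ∈ Icc a b) (ht : t ∈ Icc a b) :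
    ρ s - exp (2 * ρ s) / 2 + log (cos (ξ s)) = ρ t - exp (2 * ρ t) / 2 + log (cos (ξ t)) := by
  have hcont : ContinuousOn (fun t => ρ t - exp (2 * ρ t) / 2 + log (cos (ξ t))) (Icc a b) := by
    have h1 := h.contRho
    have h2 := h.contXi
    refine (h1.sub ((continuous_exp.comp_continuousOn (continuousOn_const.mul h1)).div_const _)).add
      ((continuous_cos.comp_continuousOn h2).log fun t ht => (h.cos_pos ht).ne')
  have key : ∀ t ∈ Icc a b, ρ t - exp (2 * ρ t) / 2 + log (cos (ξ t))
      = ρ a - exp (2 * ρ a) / 2 + log (cos (ξ a)) := by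
    intro t ht
    rcases ht.1.eq_or_lt with rfl | hat
    · rfl
    obtain ⟨c, hc, hc'⟩ := exists_hasDerivAt_eq_slope
      (fun t => ρ t - exp (2 * ρ t) / 2 + log (cos (ξ t))) (fun _ => 0) hat
      (hcont.mono (Icc_subset_Icc le_rfl ht.2)) (by
        intro x hx
        have hx' : x ∈ Ioo a b := ⟨hx.1, hx.2.trans_le ht.2⟩
        have hp := h.cos_pos (Ioo_subset_Icc_self hx')
        have h1 := ((h.derivRho x hx').sub ((((h.derivRho x hx').const_mul 2).exp).div_const 2)).add
          ((h.derivXi x hx').cos.log hp.ne')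
        refine h1.congr_deriv ?_
        rw [tan_eq_sin_div_cos]
        field_simp
        ring)
    have := sub_pos.2 hat
    rw [eq_div_iff this.ne', zero_mul] at hc'
    linarith
  rw [key s hs, key t ht]

theorem rho_strictMonoOn (h : PolarArc ρ ξ a b) (hpos : ∀ t ∈ Ioo a b, 0 < ξ t) :
    StrictMonoOn ρ (Icc a b) := by
  refine strictMonoOn_of_deriv_pos (convex_Icc a b) h.contRho fun t ht => ?_
  rw [interior_Icc] at ht
  rw [(h.derivRho t ht).deriv]
  exact tan_pos_of_pos_of_lt_pi_div_two (hpos t ht) (h.bound t (Ioo_subset_Icc_self ht)).2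

theorem xi_strictMonoOn (h : PolarArc ρ ξ a b) (hneg : ∀ t ∈ Ioo a b, ρ t < 0) :
    StrictMonoOn ξ (Icc a b) := by
  refine strictMonoOn_of_deriv_pos (convex_Icc a b) h.contXi fun t ht => ?_
  rw [interior_Icc] at ht
  rw [(h.derivXi t ht).deriv]
  have : exp (2 * ρ t) < 1 := exp_lt_one_iff.2 (by linarith [hneg t ht])
  linarith

theorem xi_strictAntiOn (h : PolarArc ρ ξ a b) (hpos : ∀ t ∈ Ioo a b, 0 < ρ t) :
    StrictAntiOn ξ (Icc a b) := by
  refine strictAntiOn_of_deriv_neg (convex_Icc a b) h.contXi fun t ht => ?_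
  rw [interior_Icc] at ht
  rw [(h.derivXi t ht).deriv]
  have : 1 < exp (2 * ρ t) := one_lt_exp_iff.2 (by linarith [hpos t ht])
  linarith

theorem angle_strictMonoOn (h : PolarArc ρ ξ a b) : StrictMonoOn (fun t => t - ξ t) (Icc a b) := by
  refine strictMonoOn_of_deriv_pos (convex_Icc a b) (continuousOn_id.sub h.contXi) fun t ht => ?_
  rw [interior_Icc] at ht
  rw [(h.derivAngle ht).deriv]
  positivity

theorem half_exp_sub_le (x : ℝ) : x - exp (2 * x) / 2 ≤ -(1 / 2) := by
  linarith [add_one_le_exp (2 * x)]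

/-- Unless `ξ` vanishes identically, its zeros do not lie on the unit circle. -/
theorem rho_ne_zero (h : PolarArc ρ ξ a b) {s t : ℝ} (hs : s ∈ Icc a b) (ht : t ∈ Icc a b)
    (hξs : ξ s ≠ 0) (hξt : ξ t = 0) : ρ t ≠ 0 := by
  intro h0
  -- The first integral is at most `-1/2`, with equality only for `ρ = 0`, `ξ = 0`. It would equal
  -- `-1/2` at `t` but is smaller at `s`.
  have h1 := h.conserved hs ht
  rw [h0, hξt, cos_zero, log_one, mul_zero, exp_zero] at h1
  have h2 := half_exp_sub_le (ρ s)
  have h3 : log (cos (ξ s)) < 0 := by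
    refine log_neg (h.cos_pos hs) (lt_of_le_of_ne (cos_le_one _) fun h4 => hξs ?_)
    have hb := h.bound s hs
    exact (cos_eq_one_iff_of_lt_of_lt (by linarith [hb.1, pi_pos]) (by linarith [hb.2, pi_pos])).1 h4
  linarith

/-- At a zero of `ξ` that ends an interval of positivity, the distance to the origin is at
least one. -/
theorem rho_nonneg_of_top (h : PolarArc ρ ξ a b) (hab : a < b) (hpos : ∀ t ∈ Ioo a b, 0 < ξ t)
    (hb : ξ b = 0) : 0 ≤ ρ b := by
  by_contra! hlt
  -- The arc would stay inside the unit disk, where `ξ` increases and cannot come down to `0`.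
  have hmono := h.rho_strictMonoOn hpos
  have hneg : ∀ t ∈ Ioo a b, ρ t < 0 := fun t ht =>
    (hmono (Ioo_subset_Icc_self ht) (right_mem_Icc.2 hab.le) ht.2).trans hlt
  have hm : (a + b) / 2 ∈ Ioo a b := ⟨by linarith, by linarith⟩
  have := h.xi_strictMonoOn hneg (Ioo_subset_Icc_self hm) (right_mem_Icc.2 hab.le) hm.2
  linarith [hpos _ hm]

theorem rho_nonpos_of_bottom (h : PolarArc ρ ξ a b) (hab : a < b) (hpos : ∀ t ∈ Ioo a b, 0 < ξ t)
    (ha : ξ a = 0) : ρ a ≤ 0 := by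
  by_contra! hlt
  have hmono := h.rho_strictMonoOn hpos
  have hneg : ∀ t ∈ Ioo a b, 0 < ρ t := fun t ht =>
    hlt.trans (hmono (left_mem_Icc.2 hab.le) (Ioo_subset_Icc_self ht) ht.1)
  have hm : (a + b) / 2 ∈ Ioo a b := ⟨by linarith, by linarith⟩
  have := h.xi_strictAntiOn hneg (left_mem_Icc.2 hab.le) (Ioo_subset_Icc_self hm) hm.1
  linarith [hpos _ hm]

end PolarArc
end ThetaShrinker

/-! ### Sturm comparison and the frequency `√2`. -/

namespace ThetaShrinker
open Real

/-- Sturm comparison: if `y` is positive and `y'' ≤ -l² y` with respect to the parameter `θ`, then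
the variation of `θ` is at most the one obtained for `y'' = -l² y`. -/
theorem sturm_le_of_pos {θ y y₁ y₂ w : ℝ → ℝ} {a b l : ℝ} (hab : a < b) (hl : 0 < l)
    (cθ : ContinuousOn θ (Icc a b)) (cy : ContinuousOn y (Icc a b)) (cy₁ : ContinuousOn y₁ (Icc a b))
    (dθ : ∀ t ∈ Ioo a b, HasDerivAt θ (w t) t) (dy : ∀ t ∈ Ioo a b, HasDerivAt y (w t * y₁ t) t)
    (dy₁ : ∀ t ∈ Ioo a b, HasDerivAt y₁ (w t * y₂ t) t) (hw : ∀ t ∈ Ioo a b, 0 ≤ w t)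
    (hy₂ : ∀ t ∈ Ioo a b, y₂ t + l ^ 2 * y t ≤ 0) (hy : ∀ t ∈ Ico a b, 0 < y t) :
    l * (θ b - θ a) ≤ π / 2 + arctan (y₁ a / (l * y a)) := by
  by_contra! hlt
  -- The phase for which `sin (ψ + l (θ - θ a))` has the logarithmic derivative of `y` at `a`. Their
  -- Wronskian then starts at `0` and does not increase while the sine is nonnegative, yet it equals
  -- `l * y c > 0` at the point `c` where the phase reaches `π`.
  set ψ := π / 2 - arctan (y₁ a / (l * y a)) with hψ
  have hψ0 : 0 ≤ ψ := by linarith [arctan_lt_pi_div_two (y₁ a / (l * y a))]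
  have hψπ : ψ < π := by linarith [neg_pi_div_two_lt_arctan (y₁ a / (l * y a))]
  obtain ⟨c, hc, hcθ⟩ : θ a + (π - ψ) / l ∈ θ '' Ioo a b := by
    refine intermediate_value_Ioo hab.le cθ ⟨?_, ?_⟩
    · have : 0 < (π - ψ) / l := div_pos (by linarith) hl
      linarith
    · have : (π - ψ) / l < θ b - θ a := by rw [div_lt_iff₀ hl]; linarith
      linarith
  have hcπ : ψ + l * (θ c - θ a) = π := by
    rw [hcθ]; field_simp; ring
  have hsub : Icc a c ⊆ Icc a b := Icc_subset_Icc le_rfl hc.2.le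
  have hθm : MonotoneOn θ (Icc a b) := by
    refine monotoneOn_of_deriv_nonneg (convex_Icc a b) cθ ?_ ?_ <;> rw [interior_Icc]
    · exact fun t ht => (dθ t ht).differentiableAt.differentiableWithinAt
    · exact fun t ht => by rw [(dθ t ht).deriv]; exact hw t ht
  have hanti : AntitoneOn (fun t => y₁ t * sin (ψ + l * (θ t - θ a))
      - l * y t * cos (ψ + l * (θ t - θ a))) (Icc a c) := by
    have hd : ∀ t ∈ Ioo a c, HasDerivAt (fun t => y₁ t * sin (ψ + l * (θ t - θ a))
      - l * y t * cos (ψ + l * (θ t - θ a)))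
        (w t * (y₂ t + l ^ 2 * y t) * sin (ψ + l * (θ t - θ a))) t := by
      intro t ht
      have ht' : t ∈ Ioo a b := ⟨ht.1, ht.2.trans hc.2⟩
      have hχ : HasDerivAt (fun t => ψ + l * (θ t - θ a)) (l * w t) t :=
        (((dθ t ht').sub_const _).const_mul l).const_add ψ
      refine (((dy₁ t ht').mul hχ.sin).sub (((dy t ht').const_mul l).mul hχ.cos)).congr_deriv ?_
      ring
    refine antitoneOn_of_deriv_nonpos (convex_Icc a c) ?_ ?_ ?_
    · have cχ : ContinuousOn (fun t => ψ + l * (θ t - θ a)) (Icc a c) :=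
        continuousOn_const.add (continuousOn_const.mul ((cθ.mono hsub).sub continuousOn_const))
      exact ((cy₁.mono hsub).mul (continuous_sin.comp_continuousOn cχ)).sub
        ((continuousOn_const.mul (cy.mono hsub)).mul (continuous_cos.comp_continuousOn cχ))
    · rw [interior_Icc]
      exact fun t ht => (hd t ht).differentiableAt.differentiableWithinAt
    · rw [interior_Icc]
      intro t ht
      have ht' : t ∈ Ioo a b := ⟨ht.1, ht.2.trans hc.2⟩
      rw [(hd t ht).deriv]
      have h1 : θ a ≤ θ t := hθm (left_mem_Icc.2 hab.le) (Ioo_subset_Icc_self ht') ht.1.le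
      have h2 : θ t ≤ θ c := hθm (Ioo_subset_Icc_self ht') (Ioo_subset_Icc_self hc) ht.2.le
      have hs : 0 ≤ sin (ψ + l * (θ t - θ a)) := by
        refine sin_nonneg_of_nonneg_of_le_pi ?_ ?_
        · nlinarith
        · rw [← hcπ]; nlinarith
      exact mul_nonpos_of_nonpos_of_nonneg
        (mul_nonpos_of_nonneg_of_nonpos (hw t ht') (hy₂ t ht')) hs
  have h1 := hanti (left_mem_Icc.2 hc.1.le) (right_mem_Icc.2 hc.1.le) hc.1.le
  have hya := hy a ⟨le_rfl, hab⟩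
  have hyc := hy c ⟨hc.1.le, hc.2⟩
  simp only [hcπ, sin_pi, cos_pi, sub_self, mul_zero, add_zero] at h1
  rw [hψ, sin_pi_div_two_sub, cos_pi_div_two_sub, sin_arctan, cos_arctan] at h1
  have h2 : y₁ a * (1 / √(1 + (y₁ a / (l * y a)) ^ 2)) - l * y a * (y₁ a / (l * y a)
      / √(1 + (y₁ a / (l * y a)) ^ 2)) = 0 := by
    have : √(1 + (y₁ a / (l * y a)) ^ 2) ≠ 0 := by positivity
    field_simp
    ring
  rw [h2] at h1
  nlinarith [mul_pos hl hyc]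

theorem sturm_le_of_pos' {θ y y₁ y₂ w : ℝ → ℝ} {a b l : ℝ} (hab : a < b) (hl : 0 < l)
    (cθ : ContinuousOn θ (Icc a b)) (cy : ContinuousOn y (Icc a b)) (cy₁ : ContinuousOn y₁ (Icc a b))
    (dθ : ∀ t ∈ Ioo a b, HasDerivAt θ (w t) t) (dy : ∀ t ∈ Ioo a b, HasDerivAt y (w t * y₁ t) t)
    (dy₁ : ∀ t ∈ Ioo a b, HasDerivAt y₁ (w t * y₂ t) t) (hw : ∀ t ∈ Ioo a b, 0 ≤ w t)
    (hy₂ : ∀ t ∈ Ioo a b, y₂ t + l ^ 2 * y t ≤ 0) (hy : ∀ t ∈ Ioc a b, 0 < y t) :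
    l * (θ b - θ a) ≤ π / 2 - arctan (y₁ b / (l * y b)) := by
  have hm : MapsTo (fun t : ℝ => -t) (Icc (-b) (-a)) (Icc a b) :=
    fun t ht => ⟨by linarith [ht.2], by linarith [ht.1]⟩
  have hm' : ∀ t ∈ Ioo (-b) (-a), -t ∈ Ioo a b := fun t ht => ⟨by linarith [ht.2], by linarith [ht.1]⟩
  have cn : ContinuousOn (fun t : ℝ => -t) (Icc (-b) (-a)) := by fun_prop
  have := sturm_le_of_pos (θ := fun t => -θ (-t)) (y := fun t => y (-t)) (y₁ := fun t => -y₁ (-t))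
    (y₂ := fun t => y₂ (-t)) (w := fun t => w (-t)) (neg_lt_neg hab) hl (cθ.comp cn hm).neg
    (cy.comp cn hm) (cy₁.comp cn hm).neg
    (fun t ht => ((dθ _ (hm' t ht)).comp t (hasDerivAt_neg t)).neg.congr_deriv (by simp))
    (fun t ht => ((dy _ (hm' t ht)).comp t (hasDerivAt_neg t)).congr_deriv (by simp))
    (fun t ht => ((dy₁ _ (hm' t ht)).comp t (hasDerivAt_neg t)).neg.congr_deriv (by simp))
    (fun t ht => hw _ (hm' t ht)) (fun t ht => hy₂ _ (hm' t ht))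
    (fun t ht => hy _ ⟨by linarith [ht.2], by linarith [ht.1]⟩)
  simp only [neg_neg, neg_div, arctan_neg] at this
  linarith

namespace PolarArc

variable {ρ ξ : ℝ → ℝ} {a b : ℝ}

/-- The function is `k ^ α`, written as an exponential. -/
theorem derivPow (h : PolarArc ρ ξ a b) (α : ℝ) {t : ℝ} (ht : t ∈ Ioo a b) :
    HasDerivAt (fun t => exp (α * (ρ t + log (cos (ξ t)))))
      (exp (ρ t) ^ 2 * (exp (α * (ρ t + log (cos (ξ t)))) * (α * (sin (ξ t) / cos (ξ t))))) t := by
  have hc := (h.cos_pos (Ioo_subset_Icc_self ht)).ne'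
  refine ((((h.derivRho t ht).add ((h.derivXi t ht).cos.log hc)).const_mul α).exp).congr_deriv ?_
  rw [show exp (2 * ρ t) = exp (ρ t) ^ 2 by rw [← exp_nat_mul]; norm_num, tan_eq_sin_div_cos]
  simp only [Pi.add_apply]
  field_simp
  ring

theorem contPow (h : PolarArc ρ ξ a b) (α : ℝ) :
    ContinuousOn (fun t => exp (α * (ρ t + log (cos (ξ t))))) (Icc a b) :=
  continuous_exp.comp_continuousOn (continuousOn_const.mul (h.contRho.add
    ((continuous_cos.comp_continuousOn h.contXi).log fun _ ht => (h.cos_pos ht).ne')))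

theorem contSin (h : PolarArc ρ ξ a b) : ContinuousOn (fun t => exp (ρ t) * sin (ξ t)) (Icc a b) :=
  (continuous_exp.comp_continuousOn h.contRho).mul (continuous_sin.comp_continuousOn h.contXi)

theorem contCos (h : PolarArc ρ ξ a b) : ContinuousOn (fun t => exp (ρ t) * cos (ξ t)) (Icc a b) :=
  (continuous_exp.comp_continuousOn h.contRho).mul (continuous_cos.comp_continuousOn h.contXi)

theorem pow_eq (h : PolarArc ρ ξ a b) {t : ℝ} (ht : t ∈ Icc a b) {α : ℝ} {n : ℕ} (hn : n * α = 1) :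
    exp (α * (ρ t + log (cos (ξ t)))) ^ n = exp (ρ t) * cos (ξ t) := by
  rw [← exp_nat_mul, ← mul_assoc, hn, one_mul, exp_add, exp_log (h.cos_pos ht)]

end PolarArc

/-- The logarithmic derivative, with respect to the tangent angle, of `k^(1/3) u`, where `k` is
the curvature and `u` the tangential component of the position. -/
noncomputable def slope (ρ ξ : ℝ) : ℝ :=
  tan ξ / 3 + (1 - (exp ρ * cos ξ) ^ 2) / (exp ρ * cos ξ * (exp ρ * sin ξ))

namespace PolarArc

variable {ρ ξ : ℝ → ℝ} {a b : ℝ}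

/-- For `y = k^α u` the tangent angle derivatives give `y'' = α(α-1) k^(α-2) u³ + (3α-1) k^(α-2) u -
(3α+1) k^α u`. The choice `α = 1/3` kills the middle term and leaves `y'' + 2y = -(2/9) k^(-5/3)
u³`. -/
theorem cubeRoot_sturm (h : PolarArc ρ ξ a b) :
    ∃ y y₁ y₂ : ℝ → ℝ, ContinuousOn y (Icc a b) ∧ ContinuousOn y₁ (Icc a b) ∧
      (∀ t ∈ Ioo a b, HasDerivAt y (exp (ρ t) ^ 2 * y₁ t) t) ∧
      (∀ t ∈ Ioo a b, HasDerivAt y₁ (exp (ρ t) ^ 2 * y₂ t) t) ∧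
      (∀ t ∈ Ioo a b, 0 ≤ ξ t → y₂ t + √2 ^ 2 * y t ≤ 0) ∧
      (∀ t ∈ Icc a b, 0 < ξ t → 0 < y t ∧ y₁ t / y t = slope (ρ t) (ξ t)) := by
  set κ := fun t => exp ((1 / 3) * (ρ t + log (cos (ξ t)))) with hκ
  have κ0 : ∀ t, 0 < κ t := fun t => exp_pos _
  have κ3 : ∀ t ∈ Icc a b, κ t ^ 3 = exp (ρ t) * cos (ξ t) :=
    fun t ht => h.pow_eq ht (by norm_num)
  set u := fun t => exp (ρ t) * sin (ξ t) with hu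
  have dκ : ∀ t ∈ Ioo a b, HasDerivAt κ (exp (ρ t) ^ 2 * (u t / (3 * κ t ^ 2))) t := by
    intro t ht
    refine (h.derivPow (1 / 3) ht).congr_deriv ?_
    have h3 := κ3 t (Ioo_subset_Icc_self ht)
    have hc := (h.cos_pos (Ioo_subset_Icc_self ht)).ne'
    have hk := (κ0 t).ne'
    change exp (ρ t) ^ 2 * (κ t * (1 / 3 * (sin (ξ t) / cos (ξ t)))) = _
    rw [hu]
    field_simp
    rw [h3]
    ring
  have du : ∀ t ∈ Ioo a b, HasDerivAt u (exp (ρ t) ^ 2 * (1 / κ t ^ 3 - κ t ^ 3)) t := by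
    intro t ht
    refine (h.derivSin ht).congr_deriv ?_
    rw [κ3 t (Ioo_subset_Icc_self ht), one_div]
  refine ⟨fun t => κ t * u t, fun t => u t ^ 2 / (3 * κ t ^ 2) + 1 / κ t ^ 2 - κ t ^ 4,
    fun t => -(2 * κ t * u t + 2 / 9 * u t ^ 3 / κ t ^ 5), (h.contPow _).mul h.contSin,
    (((h.contSin.pow 2).div (continuousOn_const.mul ((h.contPow _).pow 2))
      fun t _ => (mul_pos three_pos (pow_pos (κ0 t) 2)).ne').add
      (continuousOn_const.div ((h.contPow _).pow 2) fun t _ => (pow_pos (κ0 t) 2).ne')).sub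
      ((h.contPow _).pow 4), ?_, ?_, ?_, ?_⟩
  · intro t ht
    refine ((dκ t ht).mul (du t ht)).congr_deriv ?_
    have hk := (κ0 t).ne'
    field_simp
    ring
  · intro t ht
    have hk := (κ0 t).ne'
    have := ((((du t ht).pow 2).div (((dκ t ht).pow 2).const_mul 3)
      (mul_pos three_pos (pow_pos (κ0 t) 2)).ne').add ((hasDerivAt_const t (1 : ℝ)).div
      ((dκ t ht).pow 2) (pow_pos (κ0 t) 2).ne')).sub ((dκ t ht).pow 4)
    refine this.congr_deriv ?_
    simp only [Pi.pow_apply]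
    field_simp
    ring
  · intro t ht hξ
    rw [sq_sqrt zero_le_two]
    have hu0 : 0 ≤ u t := mul_nonneg (exp_pos _).le (sin_nonneg_of_nonneg_of_le_pi hξ
      (by linarith [(h.bound t (Ioo_subset_Icc_self ht)).2, pi_pos]))
    have : 0 ≤ 2 / 9 * u t ^ 3 / κ t ^ 5 := by have := κ0 t; positivity
    linarith
  · intro t ht hξ
    have hs : 0 < sin (ξ t) := sin_pos_of_pos_of_lt_pi hξ (by linarith [(h.bound t ht).2, pi_pos])
    have hu0 : 0 < u t := mul_pos (exp_pos _) hs
    refine ⟨mul_pos (κ0 t) hu0, ?_⟩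
    have hk := (κ0 t).ne'
    have hc := (h.cos_pos ht).ne'
    have : tan (ξ t) = u t / κ t ^ 3 := by
      rw [κ3 t ht, tan_eq_sin_div_cos, hu]
      field_simp
    rw [slope, this, ← κ3 t ht]
    change _ = u t / κ t ^ 3 / 3 + (1 - (κ t ^ 3) ^ 2) / (κ t ^ 3 * u t)
    field_simp
    ring

/-- The variation of the tangent angle up to the next point at maximal distance. -/
theorem angle_to_top_le (h : PolarArc ρ ξ a b) (hab : a < b) (hpos : ∀ t ∈ Ico a b, 0 < ξ t)
    (hb : ξ b = 0) : √2 * (b - a + ξ a) ≤ π / 2 + arctan (slope (ρ a) (ξ a) / √2) := by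
  obtain ⟨y, y₁, y₂, cy, cy₁, dy, dy₁, hy₂, hy⟩ := h.cubeRoot_sturm
  have := sturm_le_of_pos (l := √2) hab (by positivity) (continuousOn_id.sub h.contXi) cy cy₁
    (fun t ht => h.derivAngle ht) dy dy₁ (fun _ _ => by positivity)
    (fun t ht => hy₂ t ht (hpos t ⟨ht.1.le, ht.2⟩).le)
    (fun t ht => (hy t ⟨ht.1, ht.2.le⟩ (hpos t ht)).1)
  have ha : a ∈ Ico a b := ⟨le_rfl, hab⟩
  rw [← (hy a ⟨le_rfl, hab.le⟩ (hpos a ha)).2, div_div, mul_comm (y a)]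
  simp only [id, Pi.sub_apply, hb] at this
  linarith

/-- The variation of the tangent angle from the preceding point at minimal distance. -/
theorem angle_from_bottom_le (h : PolarArc ρ ξ a b) (hab : a < b) (hpos : ∀ t ∈ Ioc a b, 0 < ξ t)
    (ha : ξ a = 0) : √2 * (b - a - ξ b) ≤ π / 2 - arctan (slope (ρ b) (ξ b) / √2) := by
  obtain ⟨y, y₁, y₂, cy, cy₁, dy, dy₁, hy₂, hy⟩ := h.cubeRoot_sturm
  have := sturm_le_of_pos' (l := √2) hab (by positivity) (continuousOn_id.sub h.contXi) cy cy₁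
    (fun t ht => h.derivAngle ht) dy dy₁ (fun _ _ => by positivity)
    (fun t ht => hy₂ t ht (hpos t ⟨ht.1, ht.2.le⟩).le)
    (fun t ht => (hy t ⟨ht.1.le, ht.2⟩ (hpos t ht)).1)
  have hb : b ∈ Ioc a b := ⟨hab, le_rfl⟩
  rw [← (hy b ⟨hab.le, le_rfl⟩ (hpos b hb)).2, div_div, mul_comm (y b)]
  simp only [id, Pi.sub_apply, ha] at this
  linarith

end PolarArc
end ThetaShrinker

/-! ### Higher frequencies at higher energy: logarithm bounds and polynomial inequalities. -/

namespace ThetaShrinker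
open Real

/-- This bound and the next touch `log` at `1` to such an order that the derivative of the
difference has the factor `(x - 1)²`, respectively `(x - 1)³`. They turn the conditions on
`sturmPoly` into polynomial ones. -/
theorem two_mul_sub_div_add_le_log {z : ℝ} (hz : 1 ≤ z) : 2 * (z - 1) / (z + 1) ≤ log z := by
  have hmono : MonotoneOn (fun z => log z - 2 * (z - 1) / (z + 1)) (Ici 1) := by
    have hd : ∀ x ∈ Ioi (1 : ℝ), HasDerivAt (fun z => log z - 2 * (z - 1) / (z + 1))
        ((x - 1) ^ 2 / (x * (x + 1) ^ 2)) x := by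
      intro x hx
      have hx0 : (0 : ℝ) < x := zero_lt_one.trans hx
      have h1 : x + 1 ≠ 0 := by positivity
      refine ((hasDerivAt_log hx0.ne').sub ((((hasDerivAt_id x).sub_const 1).const_mul 2).div
        ((hasDerivAt_id x).add_const 1) h1)).congr_deriv ?_
      simp only [id]
      field_simp
      ring
    refine monotoneOn_of_deriv_nonneg (convex_Ici 1) ?_ ?_ ?_
    · refine (continuousOn_log.mono fun x (hx : 1 ≤ x) => ?_).sub
        (ContinuousOn.div (by fun_prop) (by fun_prop) fun x (hx : 1 ≤ x) => by positivity)
      exact (zero_lt_one.trans_le hx).ne'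
    · rw [interior_Ici]
      exact fun x hx => (hd x hx).differentiableAt.differentiableWithinAt
    · rw [interior_Ici]
      intro x hx
      have hx0 : (0 : ℝ) < x := zero_lt_one.trans hx
      rw [(hd x hx).deriv]
      positivity
  have := hmono (mem_Ici.2 le_rfl) hz hz
  simp only [log_one, sub_self, mul_zero, zero_div] at this
  linarith

theorem neg_div_le_log {z : ℝ} (hz : 0 < z) (hz1 : z ≤ 1) :
    -((1 - z) * (1 + 5 * z) / (2 * z * (2 + z))) ≤ log z := by
  have hanti : AntitoneOn (fun z => log z + (1 - z) * (1 + 5 * z) / (2 * z * (2 + z))) (Ioc 0 1) := by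
    have hd : ∀ x ∈ Ioo (0 : ℝ) 1, HasDerivAt
        (fun z => log z + (1 - z) * (1 + 5 * z) / (2 * z * (2 + z)))
        ((x - 1) ^ 3 / (x ^ 2 * (2 + x) ^ 2)) x := by
      intro x hx
      have hx0 := hx.1
      have h1 : 2 * x * (2 + x) ≠ 0 := by positivity
      refine ((hasDerivAt_log hx0.ne').add ((((hasDerivAt_id x).const_sub 1).mul
        (((hasDerivAt_id x).const_mul 5).const_add 1)).div
        (((hasDerivAt_id x).const_mul 2).mul ((hasDerivAt_id x).const_add 2)) h1)).congr_deriv ?_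
      simp only [id, Pi.mul_apply]
      field_simp
      ring
    refine antitoneOn_of_deriv_nonpos (convex_Ioc 0 1) ?_ ?_ ?_
    · refine (continuousOn_log.mono fun x hx => hx.1.ne').add
        (ContinuousOn.div (by fun_prop) (by fun_prop) fun x hx => ?_)
      have := hx.1
      positivity
    · rw [interior_Ioc]
      exact fun x hx => (hd x hx).differentiableAt.differentiableWithinAt
    · rw [interior_Ioc]
      intro x hx
      have hx0 := hx.1
      rw [(hd x hx).deriv]
      refine div_nonpos_of_nonpos_of_nonneg ?_ (by positivity)
      have := hx.2
      exact Odd.pow_nonpos (by decide) (by linarith)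
  have := hanti ⟨hz, hz1⟩ (right_mem_Ioc.2 zero_lt_one) hz1
  simp only [log_one, sub_self, zero_mul, zero_div, add_zero] at this
  linarith

/-- The polynomial which governs the sign of `y'' + l y` for `y = (1 + c √k + d k) u`, where
`z = √k` and `v = u²`. -/
noncomputable def sturmPoly (l c d z v : ℝ) : ℝ :=
  -1 + (l - 1) * z ^ 4 + c * (z / 2 + (l - 5 / 2) * z ^ 5 - z * v / 4)
    + d * (2 * z ^ 2 + (l - 4) * z ^ 6)

/-- The coefficient of `v` is `-(c / 4) z ≤ 0`, so a lower bound for `v` suffices: `0` for small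
`z`, and elsewhere the energy bound `he`, with `log` replaced by a rational minorant on each side of
`1` and denominators cleared. -/
theorem sturmPoly_nonpos_of {l c d e z₀ : ℝ} (hc : 0 ≤ c)
    (h₁ : ∀ z, 0 < z → z ≤ z₀ → sturmPoly l c d z 0 ≤ 0)
    (h₂ : ∀ z, z₀ ≤ z → z ≤ 1 → (2 + z) * sturmPoly l c d z 0
      - c / 4 * (z * (e - z ^ 4) * (2 + z) - 2 * (1 - z) * (1 + 5 * z)) ≤ 0)
    (h₃ : ∀ z, 1 ≤ z → (z + 1) * sturmPoly l c d z 0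
      - c / 4 * (z * (e - z ^ 4) * (z + 1) + 8 * z * (z - 1)) ≤ 0)
    {z v : ℝ} (hz : 0 < z) (hv : 0 ≤ v) (he : e + 4 * log z - z ^ 4 ≤ v) :
    sturmPoly l c d z v ≤ 0 := by
  have hsplit : sturmPoly l c d z v = sturmPoly l c d z 0 - c / 4 * z * v := by
    simp only [sturmPoly]; ring
  have hcz : 0 ≤ c / 4 * z := by positivity
  rw [hsplit]
  rcases le_total z z₀ with h | h
  · have := h₁ z hz h
    have := mul_nonneg hcz hv
    linarith
  have hle := mul_le_mul_of_nonneg_left he hcz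
  rcases le_total z 1 with h' | h'
  · have h4 := h₂ z h h'
    have h5 := mul_le_mul_of_nonneg_left (neg_div_le_log hz h') hcz
    have h6 : c / 4 * z * -((1 - z) * (1 + 5 * z) / (2 * z * (2 + z))) * (4 * (2 + z))
        = - (c / 4) * (2 * (1 - z) * (1 + 5 * z)) := by field_simp; ring
    have h7 : 0 < 2 + z := by linarith
    have h8 := mul_le_mul_of_nonneg_right h5 (by linarith : 0 ≤ 4 * (2 + z))
    rw [h6] at h8
    have h9 := mul_le_mul_of_nonneg_right hle h7.le
    by_contra! h10
    nlinarith [mul_pos h10 h7]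
  · have h4 := h₃ z h'
    have h5 := mul_le_mul_of_nonneg_left (two_mul_sub_div_add_le_log h') hcz
    have h7 : 0 < z + 1 := by linarith
    have h6 : c / 4 * z * (2 * (z - 1) / (z + 1)) * (4 * (z + 1))
        = c / 4 * (8 * z * (z - 1)) := by field_simp; ring
    have h8 := mul_le_mul_of_nonneg_right h5 (by linarith : 0 ≤ 4 * (z + 1))
    rw [h6] at h8
    have h9 := mul_le_mul_of_nonneg_right hle h7.le
    by_contra! h10
    nlinarith [mul_pos h10 h7]

/-- The value `9/4 = (3/2)²` belongs to the frequency at which the crude bound `π / l` on the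
turning is already `2π / 3`. -/
theorem sturmPoly_nonpos_of_large {z v : ℝ} (hz : 0 < z) (hv : 0 ≤ v)
    (he : 249 / 100 + 4 * log z - z ^ 4 ≤ v) : sturmPoly (9 / 4) (14 / 5) (13 / 50) z v ≤ 0 := by
  refine sturmPoly_nonpos_of (z₀ := 11 / 20) (by norm_num) ?_ ?_ ?_ hz hv he
  · intro z h0 h1
    have e1 : 0 ≤ z * (11 / 20 - z) := by nlinarith
    rw [sturmPoly]
    nlinarith [pow_pos h0 5, pow_pos h0 6, mul_nonneg e1 (sq_nonneg z), mul_nonneg e1 h0.le,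
      pow_pos h0 4]
  · intro z h0 h1
    obtain ⟨a, rfl⟩ : ∃ a, z = 11 / 20 + a := ⟨z - 11 / 20, by ring⟩
    have ha : 0 ≤ a := by linarith
    have hb : 0 ≤ 9 / 20 - a := by linarith
    rw [sturmPoly]
    nlinarith [mul_nonneg ha hb, mul_nonneg (pow_nonneg ha 2) hb, mul_nonneg (pow_nonneg ha 3) hb,
      mul_nonneg (pow_nonneg ha 4) hb, mul_nonneg (pow_nonneg ha 5) hb,
      mul_nonneg (pow_nonneg ha 6) hb, sq_nonneg (a - 1 / 4), mul_nonneg ha (sq_nonneg (a - 1 / 4))]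
  · intro z h0
    obtain ⟨a, rfl⟩ : ∃ a, z = 1 + a := ⟨z - 1, by ring⟩
    have ha : 0 ≤ a := by linarith
    rw [sturmPoly]
    nlinarith [pow_nonneg ha 3, pow_nonneg ha 4, pow_nonneg ha 5, pow_nonneg ha 6, pow_nonneg ha 7,
      sq_nonneg (a - 1 / 10), mul_nonneg ha (sq_nonneg (a - 1 / 10)),
      mul_nonneg ha (sq_nonneg (a - 1 / 5)), mul_nonneg (sq_nonneg a) (sq_nonneg (a - 1 / 10))]

/-- The value `5351/2500` lies just above `1.463²`, the squared frequency used for intermediate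
energies. -/
theorem sturmPoly_nonpos_of_middle {z v : ℝ} (hz : 0 < z) (hv : 0 ≤ v)
    (he : 187 / 100 + 4 * log z - z ^ 4 ≤ v) :
    sturmPoly (5351 / 2500) (12 / 5) (1 / 8) z v ≤ 0 := by
  refine sturmPoly_nonpos_of (z₀ := 3 / 5) (by norm_num) ?_ ?_ ?_ hz hv he
  · intro z h0 h1
    have e1 : 0 ≤ z * (3 / 5 - z) := by nlinarith
    rw [sturmPoly]
    nlinarith [pow_pos h0 5, pow_pos h0 6, mul_nonneg e1 (sq_nonneg z), mul_nonneg e1 h0.le,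
      pow_pos h0 4]
  · intro z h0 h1
    obtain ⟨a, rfl⟩ : ∃ a, z = 3 / 5 + a := ⟨z - 3 / 5, by ring⟩
    have ha : 0 ≤ a := by linarith
    have hb : 0 ≤ 2 / 5 - a := by linarith
    rw [sturmPoly]
    nlinarith [mul_nonneg ha hb, mul_nonneg (pow_nonneg ha 2) hb, mul_nonneg (pow_nonneg ha 3) hb,
      mul_nonneg (pow_nonneg ha 4) hb, mul_nonneg (pow_nonneg ha 5) hb,
      mul_nonneg (pow_nonneg ha 6) hb, sq_nonneg (a - 1 / 4), mul_nonneg ha (sq_nonneg (a - 1 / 4))]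
  · intro z h0
    obtain ⟨a, rfl⟩ : ∃ a, z = 1 + a := ⟨z - 1, by ring⟩
    have ha : 0 ≤ a := by linarith
    rw [sturmPoly]
    nlinarith [pow_nonneg ha 3, pow_nonneg ha 4, pow_nonneg ha 5, pow_nonneg ha 6, pow_nonneg ha 7,
      sq_nonneg (a - 1 / 10), mul_nonneg ha (sq_nonneg (a - 1 / 10)),
      mul_nonneg ha (sq_nonneg (a - 1 / 5)), mul_nonneg (sq_nonneg a) (sq_nonneg (a - 1 / 10))]

/-- The energy `r² - 2 log k` of a point of a shrinking arc. -/
noncomputable def energy (ρ ξ : ℝ) : ℝ := exp ρ ^ 2 - 2 * (ρ + log (cos ξ))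

namespace PolarArc

variable {ρ ξ : ℝ → ℝ} {a b : ℝ}

theorem energy_eq (h : PolarArc ρ ξ a b) {s t : ℝ} (hs : s ∈ Icc a b) (ht : t ∈ Icc a b) :
    energy (ρ s) (ξ s) = energy (ρ t) (ξ t) := by
  have := h.conserved hs ht
  have e : ∀ x, exp (2 * x) = exp x ^ 2 := fun x => by rw [← exp_nat_mul]; norm_num
  rw [energy, energy]
  rw [e, e] at this
  linarith

/-- Sturm comparison with the function `(1 + c √k + d k) u`. -/
theorem angle_to_top_le_of_sturmPoly (h : PolarArc ρ ξ a b) (hab : a < b)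
    (hpos : ∀ t ∈ Ico a b, 0 < ξ t) (hb : ξ b = 0) {l l₂ c d : ℝ} (hl : 0 < l) (hl₂ : l ^ 2 ≤ l₂)
    (hc : 0 ≤ c) (hd : 0 ≤ d)
    (hP : ∀ z v : ℝ, 0 < z → 0 ≤ v → energy (ρ a) (ξ a) + 4 * log z - z ^ 4 ≤ v →
      sturmPoly l₂ c d z v ≤ 0) :
    ∃ m, 0 ≤ m ∧ m ≤ 1 ∧
      l * (b - a + ξ a) ≤ π / 2 + arctan ((m * tan (ξ a) + (1 - (exp (ρ a) * cos (ξ a)) ^ 2) /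
        (exp (ρ a) * cos (ξ a) * (exp (ρ a) * sin (ξ a)))) / l) := by
  set z := fun t => exp ((1 / 2) * (ρ t + log (cos (ξ t)))) with hz
  have z0 : ∀ t, 0 < z t := fun t => exp_pos _
  have z2 : ∀ t ∈ Icc a b, z t ^ 2 = exp (ρ t) * cos (ξ t) :=
    fun t ht => h.pow_eq ht (by norm_num)
  set u := fun t => exp (ρ t) * sin (ξ t) with hu
  have dz : ∀ t ∈ Ioo a b, HasDerivAt z (exp (ρ t) ^ 2 * (u t / (2 * z t))) t := by
    intro t ht
    refine (h.derivPow (1 / 2) ht).congr_deriv ?_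
    have h2 := z2 t (Ioo_subset_Icc_self ht)
    have hc := (h.cos_pos (Ioo_subset_Icc_self ht)).ne'
    have hk := (z0 t).ne'
    change exp (ρ t) ^ 2 * (z t * (1 / 2 * (sin (ξ t) / cos (ξ t)))) = _
    rw [hu]
    field_simp
    rw [h2]
    ring
  have du : ∀ t ∈ Ioo a b, HasDerivAt u (exp (ρ t) ^ 2 * (1 / z t ^ 2 - z t ^ 2)) t := by
    intro t ht
    refine (h.derivSin ht).congr_deriv ?_
    rw [z2 t (Ioo_subset_Icc_self ht), one_div]
  have u0 : ∀ t ∈ Ico a b, 0 < u t := fun t ht => mul_pos (exp_pos _)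
    (sin_pos_of_pos_of_lt_pi (hpos t ht) (by linarith [(h.bound t ⟨ht.1, ht.2.le⟩).2, pi_pos]))
  have m0 : ∀ t, 0 < 1 + c * z t + d * z t ^ 2 := fun t => by
    have := z0 t
    positivity
  have cz := h.contPow (1 / 2)
  have ha : a ∈ Icc a b := left_mem_Icc.2 hab.le
  have key := sturm_le_of_pos (l := l) (θ := fun t => t - ξ t)
    (y := fun t => (1 + c * z t + d * z t ^ 2) * u t)
    (y₁ := fun t => (c / (2 * z t) + d) * u t ^ 2
      + (1 + c * z t + d * z t ^ 2) * (1 / z t ^ 2 - z t ^ 2))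
    (y₂ := fun t => u t * (-(c / (4 * z t ^ 3)) * u t ^ 2
      + 3 * (c / (2 * z t) + d) * (1 / z t ^ 2 - z t ^ 2)
      - (1 + c * z t + d * z t ^ 2) * (1 + 1 / z t ^ 4)))
    (w := fun t => exp (ρ t) ^ 2) hab hl (continuousOn_id.sub h.contXi)
    (((continuousOn_const.add (continuousOn_const.mul cz)).add
      (continuousOn_const.mul (cz.pow 2))).mul h.contSin)
    ((((continuousOn_const.div (continuousOn_const.mul cz) fun t _ =>
      (mul_pos two_pos (z0 t)).ne').add continuousOn_const).mul (h.contSin.pow 2)).add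
      (((continuousOn_const.add (continuousOn_const.mul cz)).add
      (continuousOn_const.mul (cz.pow 2))).mul ((continuousOn_const.div (cz.pow 2) fun t _ =>
      (pow_pos (z0 t) 2).ne').sub (cz.pow 2))))
    (fun t ht => h.derivAngle ht) ?_ ?_ (fun _ _ => by positivity) ?_ ?_
  · refine ⟨(c * z a / 2 + d * z a ^ 2) / (1 + c * z a + d * z a ^ 2), ?_, ?_, ?_⟩
    · have := z0 a
      positivity
    · have := z0 a
      rw [div_le_one (m0 a)]
      nlinarith [mul_nonneg hc this.le]
    · simp only [hb, sub_zero] at key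
      convert key using 3
      · ring
      · have hua := (u0 a ⟨le_rfl, hab⟩).ne'
        have hza := (z0 a).ne'
        have hm := (m0 a).ne'
        have hcos := (h.cos_pos ha).ne'
        have : tan (ξ a) = u a / z a ^ 2 := by
          rw [z2 a ha, tan_eq_sin_div_cos, hu]
          field_simp
        rw [this, ← z2 a ha]
        change (_ + (1 - (z a ^ 2) ^ 2) / (z a ^ 2 * u a)) / l = _
        generalize 1 + c * z a + d * z a ^ 2 = M at hm
        field_simp
  · intro t ht
    have hk := (z0 t).ne'
    refine (((((dz t ht).const_mul c).const_add 1).add (((dz t ht).pow 2).const_mul d)).mul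
      (du t ht)).congr_deriv ?_
    simp only [Pi.add_apply, Pi.pow_apply]
    field_simp
    ring
  · intro t ht
    have hk := (z0 t).ne'
    refine (((((hasDerivAt_const t c).div ((dz t ht).const_mul 2) (mul_pos two_pos (z0 t)).ne').add_const
      d).mul ((du t ht).pow 2)).add (((((dz t ht).const_mul c).const_add 1).add
      (((dz t ht).pow 2).const_mul d)).mul (((hasDerivAt_const t (1 : ℝ)).div ((dz t ht).pow 2)
      (pow_pos (z0 t) 2).ne').sub ((dz t ht).pow 2)))).congr_deriv ?_
    simp only [Pi.add_apply, Pi.pow_apply, Pi.div_apply, Pi.sub_apply]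
    field_simp
    ring
  · intro t ht
    have ht' := Ioo_subset_Icc_self ht
    have hut := u0 t ⟨ht.1.le, ht.2⟩
    have hk := z0 t
    -- Energy conservation with `r² = u² + k²` and `k = z²`; equality holds.
    have hE : energy (ρ a) (ξ a) + 4 * log (z t) - z t ^ 4 ≤ u t ^ 2 := by
      rw [h.energy_eq ha ht', energy, hz, log_exp]
      have : exp (ρ t) ^ 2 = u t ^ 2 + z t ^ 4 := by
        rw [show z t ^ 4 = (z t ^ 2) ^ 2 by ring, z2 t ht', hu]
        linear_combination -exp (ρ t) ^ 2 * sin_sq_add_cos_sq (ξ t)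
      change exp (ρ t) ^ 2 - 2 * (ρ t + log (cos (ξ t))) +
        4 * (1 / 2 * (ρ t + log (cos (ξ t)))) - z t ^ 4 ≤ u t ^ 2
      linarith
    have h1 := hP (z t) (u t ^ 2) hk (sq_nonneg _) hE
    have h2 : u t * (-(c / (4 * z t ^ 3)) * u t ^ 2
      + 3 * (c / (2 * z t) + d) * (1 / z t ^ 2 - z t ^ 2)
      - (1 + c * z t + d * z t ^ 2) * (1 + 1 / z t ^ 4)) + l₂ * ((1 + c * z t + d * z t ^ 2) * u t)
      = u t * (sturmPoly l₂ c d (z t) (u t ^ 2) / z t ^ 4) := by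
      rw [sturmPoly]
      field_simp
      ring
    have h3 : u t * (sturmPoly l₂ c d (z t) (u t ^ 2) / z t ^ 4) ≤ 0 :=
      mul_nonpos_of_nonneg_of_nonpos hut.le (div_nonpos_of_nonpos_of_nonneg h1 (by positivity))
    have h4 := mul_le_mul_of_nonneg_right hl₂ (mul_pos (m0 t) hut).le
    change _ + l ^ 2 * ((1 + c * z t + d * z t ^ 2) * u t) ≤ 0
    linarith
  · exact fun t ht => mul_pos (m0 t) (u0 t ht)

end PolarArc
end ThetaShrinker

/-! ### The turning bound `2π / 3` for arcs that start with `ξ ≥ π / 6`. -/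

namespace ThetaShrinker
open Real

theorem div_one_add_sq_le_arctan {x : ℝ} (hx : 0 ≤ x) : x / (1 + x ^ 2) ≤ arctan x := by
  have h1 : sin (2 * arctan x) ≤ 2 * arctan x := sin_le (by simpa using arctan_nonneg.2 hx)
  rw [sin_two_mul, sin_arctan, cos_arctan] at h1
  have h2 : 2 * (x / √(1 + x ^ 2)) * (1 / √(1 + x ^ 2)) = 2 * (x / (1 + x ^ 2)) := by
    have : √(1 + x ^ 2) ^ 2 = 1 + x ^ 2 := sq_sqrt (by positivity)
    have : √(1 + x ^ 2) ≠ 0 := by positivity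
    have : 1 + x ^ 2 ≠ 0 := by positivity
    field_simp
    rw [sq_sqrt (by positivity)]
  linarith

theorem arctan_le_sub_div {x : ℝ} (hx : 0 < x) : arctan x ≤ π / 2 - x / (1 + x ^ 2) := by
  have h1 := arctan_inv_of_pos hx
  have h2 := div_one_add_sq_le_arctan (inv_pos.2 hx).le
  have h3 : x⁻¹ / (1 + x⁻¹ ^ 2) = x / (1 + x ^ 2) := by field_simp; ring
  linarith

/-- Since `arctan x ≤ π/2 - x/(1 + x²)`, the turning satisfies `l Θ ≤ π - W l / (l² + W²)`, and `h`
puts the right side below `2π l / 3`, with `3.1416` in place of `π`. -/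
theorem lt_of_sturm_bound {l w W Θ : ℝ} (hl : 0 < l) (hwW : w ≤ W) (hW : 0 < W)
    (hΘ : l * Θ ≤ π / 2 + arctan (w / l)) (h : 3.1416 * (1 - 2 * l / 3) * (l ^ 2 + W ^ 2) < W * l)
    (hl' : l ≤ 3 / 2) : Θ < 2 * π / 3 := by
  have h1 : arctan (w / l) ≤ arctan (W / l) := arctan_mono (by gcongr)
  have h2 := arctan_le_sub_div (div_pos hW hl)
  have h3 : W / l / (1 + (W / l) ^ 2) = W * l / (l ^ 2 + W ^ 2) := by field_simp
  have h4 : 3.1416 * (1 - 2 * l / 3) < W * l / (l ^ 2 + W ^ 2) := by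
    rw [lt_div_iff₀ (by positivity)]; exact h
  have h5 : π * (1 - 2 * l / 3) ≤ 3.1416 * (1 - 2 * l / 3) :=
    mul_le_mul_of_nonneg_right pi_lt_d4.le (by linarith)
  have h6 : l * Θ < l * (2 * π / 3) := by nlinarith
  exact lt_of_mul_lt_mul_left h6 hl.le

/-- The function `4/3 K - log K` decreases on `(0, 3/4]`, so an upper bound on it keeps `K` away
from `0`. -/
theorem inv_le_of_sub_log_le {K κ e : ℝ} (hK : 0 < K) (hκ : 0 < κ) (hκ' : κ ≤ 3 / 4)
    (he : e < 4 / 3 * κ - log κ) (h : 4 / 3 * K - log K ≤ e) : 1 / K ≤ 1 / κ := by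
  by_contra! hlt
  have hKκ : K < κ := (one_div_lt_one_div hκ hK).1 hlt
  have h1 : 1 - (κ / K)⁻¹ ≤ log (κ / K) := one_sub_inv_le_log_of_pos (div_pos hκ hK)
  rw [inv_div, log_div hκ.ne' hK.ne'] at h1
  have h2 : K / κ * κ = K := by field_simp
  have h3 : K / κ ≤ 1 := (div_le_one hκ).2 hKκ.le
  nlinarith

/-- Here `K = k²` and `t = tan ξ` at the starting point. For `t ≤ 1` one uses `1/t ≤ √3 < 1.7321`;
for `t ≥ 1` the energy bound and `log K ≤ K - 1` give `t² ≤ (e - 1) J`. -/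
theorem initial_slope_le {K t m J W e : ℝ} (hK : 0 < K) (ht0 : 0 < t) (ht : 1 / 3 ≤ t ^ 2)
    (hm : 0 ≤ m) (he : K * (1 + t ^ 2) - log K ≤ e) (hJ : 1 / K ≤ J) (hJ1 : 1 ≤ J)
    (h₁ : m + 1.7321 * (J - 1) ≤ W) (h₂ : ∀ s, 0 < s → s ^ 2 ≤ (e - 1) * J → m * s + (J - 1) ≤ W) :
    m * t + (1 / K - 1) / t ≤ W := by
  have h3 : (1 / K - 1) / t ≤ (J - 1) * (1 / t) := by
    rw [mul_one_div]
    gcongr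
  have hJ0 : 0 ≤ J - 1 := by linarith
  rcases le_total t 1 with h | h
  · have h4 : 1 / t ≤ 1.7321 := by
      rw [div_le_iff₀ ht0]
      by_contra! h5
      nlinarith
    nlinarith [mul_le_mul_of_nonneg_left h4 hJ0, mul_le_mul_of_nonneg_left h hm]
  · have h4 : 1 / t ≤ 1 := (div_le_one ht0).2 h
    have h5 : t ^ 2 ≤ (e - 1) * J := by
      have h6 : t ^ 2 * K ≤ e - 1 := by linarith [log_le_sub_one_of_pos hK]
      have h7 : 0 ≤ e - 1 := le_trans (by positivity) h6
      calc t ^ 2 = t ^ 2 * K * (1 / K) := by field_simp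
        _ ≤ (e - 1) * J := by gcongr
    nlinarith [mul_le_mul_of_nonneg_left h4 hJ0, h₂ t ht0 h5]

namespace PolarArc

variable {ρ ξ : ℝ → ℝ} {a b : ℝ}

/-- A shrinking arc that starts with `ξ ≥ π / 6` reaches its next point at maximal distance before
its tangent has turned by the angle `2π / 3`, counted from the position vector. -/
theorem angle_to_top_lt (h : PolarArc ρ ξ a b) (hab : a < b) (hpos : ∀ t ∈ Ico a b, 0 < ξ t)
    (hb : ξ b = 0) (hξ : π / 6 ≤ ξ a) : b - a + ξ a < 2 * π / 3 := by
  have ha : a ∈ Icc a b := left_mem_Icc.2 hab.le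
  have hbd := h.bound a ha
  have hcos := h.cos_pos ha
  set k := exp (ρ a) * cos (ξ a) with hk
  set t := tan (ξ a) with ht
  have hk0 : 0 < k := mul_pos (exp_pos _) hcos
  have hu : exp (ρ a) * sin (ξ a) = k * t := by
    rw [hk, ht, tan_eq_sin_div_cos]
    field_simp
  have ht0 : 0 < t := tan_pos_of_pos_of_lt_pi_div_two (by linarith [pi_pos]) hbd.2
  have ht3 : 1 / 3 ≤ t ^ 2 := by
    have h1 : tan (π / 6) ≤ t := strictMonoOn_tan.monotoneOn
      ⟨by linarith [pi_pos], by linarith [pi_pos]⟩ hbd hξ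
    rw [tan_pi_div_six] at h1
    calc (1 : ℝ) / 3 = (1 / √3) ^ 2 := by rw [div_pow, sq_sqrt zero_le_three, one_pow]
      _ ≤ t ^ 2 := by gcongr
  have hw : (1 - k ^ 2) / (k * (exp (ρ a) * sin (ξ a))) = (1 / k ^ 2 - 1) / t := by
    rw [hu]
    field_simp
  have hE : energy (ρ a) (ξ a) = k ^ 2 * (1 + t ^ 2) - log (k ^ 2) := by
    have h1 : exp (ρ a) ^ 2 = k ^ 2 + (k * t) ^ 2 := by
      rw [← hu, hk]
      linear_combination -exp (ρ a) ^ 2 * sin_sq_add_cos_sq (ξ a)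
    rw [energy, h1, log_pow, hk, log_mul (exp_pos _).ne' hcos.ne', log_exp]
    push_cast
    ring
  have hK : 0 < k ^ 2 := by positivity
  have hE' : 4 / 3 * k ^ 2 - log (k ^ 2) ≤ energy (ρ a) (ξ a) := by
    rw [hE]
    nlinarith
  have l2 := log_two_gt_d9
  -- Low energy bounds the initial slope well enough for the frequency `√2`. High energy allows the
  -- frequency `3/2`, for which any slope will do. In between, `1.463` and a weaker slope bound
  -- work. The values `J = 5` and `J = 32/3` bound `1/k²`; `W = 7.27` and `W = 17.8` bound the
  -- slope.
  rcases le_total (energy (ρ a) (ξ a)) (187 / 100) with hE1 | hE1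
  · have h1 := h.angle_to_top_le hab hpos hb
    rw [slope, ← hk, hw, ← ht] at h1
    have hJ : 1 / k ^ 2 ≤ 1 / (1 / 5) := by
      refine inv_le_of_sub_log_le (e := 187 / 100) hK (by norm_num) (by norm_num) ?_
        (hE'.trans hE1)
      have h2 := two_mul_sub_div_add_le_log (z := 5 / 4) (by norm_num)
      have h3 : log (1 / 5) = -(log (5 / 4) + 2 * log 2) := by
        rw [show (2 : ℝ) * log 2 = log (2 ^ 2) by rw [log_pow]; norm_num,
          ← log_mul (by norm_num) (by norm_num), ← log_inv]
        norm_num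
      rw [h3]
      norm_num at h2
      linarith
    have h2 := initial_slope_le (m := 1 / 3) (J := 5) (W := 7.27) hK ht0 ht3 (by norm_num)
      (hE ▸ hE1) (by linarith) (by norm_num) (by norm_num) (fun s hs hs' => by nlinarith)
    have hs : √2 ^ 2 = 2 := sq_sqrt zero_le_two
    have hs' : 1.414 < √2 := lt_sqrt_of_sq_lt (by norm_num)
    have hs'' : √2 ≤ 3 / 2 := by nlinarith
    refine lt_of_sturm_bound (l := √2) (by positivity) h2 (by norm_num) ?_ ?_ hs''
    · convert h1 using 4
      ring
    · rw [hs]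
      linarith
  rcases le_total (energy (ρ a) (ξ a)) (249 / 100) with hE2 | hE2
  · obtain ⟨m, hm0, hm1, h1⟩ := h.angle_to_top_le_of_sturmPoly hab hpos hb (l := 1.463)
      (by norm_num) (by norm_num) (by norm_num) (by norm_num) fun z v hz hv he =>
        sturmPoly_nonpos_of_middle hz hv (by linarith)
    rw [← hk, hw, ← ht] at h1
    have hJ : 1 / k ^ 2 ≤ 1 / (3 / 32) := by
      refine inv_le_of_sub_log_le (e := 249 / 100) hK (by norm_num) (by norm_num) ?_
        (hE'.trans hE2)
      have h2 := two_mul_sub_div_add_le_log (z := 4 / 3) (by norm_num)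
      have h3 : log (3 / 32) = -(log (4 / 3) + 3 * log 2) := by
        rw [show (3 : ℝ) * log 2 = log (2 ^ 3) by rw [log_pow]; norm_num,
          ← log_mul (by norm_num) (by norm_num), ← log_inv]
        norm_num
      rw [h3]
      norm_num at h2
      linarith
    have h2 := initial_slope_le (m := m) (J := 32 / 3) (W := 17.8) hK ht0 ht3 hm0
      (hE ▸ hE2) (by linarith) (by norm_num) (by linarith) (fun s hs hs' => by nlinarith)
    exact lt_of_sturm_bound (by norm_num) h2 (by norm_num) h1 (by norm_num) (by norm_num)
  · obtain ⟨m, hm0, hm1, h1⟩ := h.angle_to_top_le_of_sturmPoly hab hpos hb (l := 3 / 2)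
      (by norm_num) (by norm_num) (by norm_num) (by norm_num) fun z v hz hv he =>
        sturmPoly_nonpos_of_large hz hv (by linarith)
    have h2 := arctan_lt_pi_div_two ((m * t + (1 - k ^ 2) / (k * (exp (ρ a) * sin (ξ a)))) / (3 / 2))
    linarith

end PolarArc
end ThetaShrinker

/-! ### Polar distance between extrema, and their order along an arc. -/

namespace ThetaShrinker
open Real

theorem exists_first_nonpos {f : ℝ → ℝ} {a b : ℝ} (hab : a ≤ b) (hf : ContinuousOn f (Icc a b))
    (ha : 0 < f a) (hb : f b ≤ 0) : ∃ t ∈ Ioc a b, f t = 0 ∧ ∀ s ∈ Ico a t, 0 < f s := by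
  have hclosed : IsClosed (Icc a b ∩ f ⁻¹' Iic 0) :=
    hf.preimage_isClosed_of_isClosed isClosed_Icc isClosed_Iic
  obtain ⟨t, ⟨ht, ht0⟩, hleast⟩ := (isCompact_Icc.of_isClosed_subset hclosed
    inter_subset_left).exists_isLeast ⟨b, right_mem_Icc.2 hab, hb⟩
  have hpos : ∀ s ∈ Ico a t, 0 < f s := fun s hs => by
    by_contra! h
    exact (hleast ⟨⟨hs.1, hs.2.le.trans ht.2⟩, h⟩).not_gt hs.2
  have hat : a < t := by
    refine lt_of_le_of_ne ht.1 fun h => ?_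
    rw [← h] at ht0
    exact ha.not_ge ht0
  refine ⟨t, ⟨hat, ht.2⟩, le_antisymm ht0 ?_, hpos⟩
  by_contra! hneg
  obtain ⟨s, hs, hs0⟩ := intermediate_value_Icc' hat.le (hf.mono (Icc_subset_Icc le_rfl ht.2))
    (⟨hneg.le, ha.le⟩ : (0 : ℝ) ∈ Icc (f t) (f a))
  have : s ≠ t := by
    rintro rfl
    linarith
  have := hpos s ⟨hs.1, lt_of_le_of_ne hs.2 this⟩
  linarith

/-- A function that starts nonnegative and increases at each of its zeros stays nonnegative. -/
theorem nonneg_of_deriv_pos_at_zeros {D d : ℝ → ℝ} {a b : ℝ} (hD : ContinuousOn D (Icc a b))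
    (hd : ContinuousOn d (Icc a b)) (hderiv : ∀ t ∈ Ioo a b, HasDerivAt D (d t) t) (ha : 0 ≤ D a)
    (hzero : ∀ t ∈ Ico a b, D t = 0 → 0 < d t) : ∀ t ∈ Icc a b, 0 ≤ D t := by
  intro t ht
  by_contra! hneg
  have hclosed : IsClosed (Icc a t ∩ D ⁻¹' Ici 0) :=
    (hD.mono (Icc_subset_Icc le_rfl ht.2)).preimage_isClosed_of_isClosed isClosed_Icc isClosed_Ici
  obtain ⟨s, ⟨hs, hs0⟩, hgr⟩ := (isCompact_Icc.of_isClosed_subset hclosed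
    inter_subset_left).exists_isGreatest ⟨a, left_mem_Icc.2 ht.1, ha⟩
  have hst : s < t := lt_of_le_of_ne hs.2 fun h => by
    rw [h] at hs0
    exact hneg.not_ge hs0
  have hafter : ∀ x ∈ Ioc s t, D x < 0 := fun x hx => by
    by_contra! h
    exact (hgr ⟨⟨hs.1.trans hx.1.le, hx.2⟩, h⟩).not_gt hx.1
  have hs1 : s ∈ Icc a b := ⟨hs.1, hs.2.trans ht.2⟩
  have hsub : Icc s t ⊆ Icc a b := Icc_subset_Icc hs.1 ht.2
  have hzs : D s = 0 := by
    refine le_antisymm ?_ hs0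
    by_contra! h
    obtain ⟨x, hx, hx0⟩ := intermediate_value_Icc' hst.le (hD.mono hsub)
      (⟨by linarith, by linarith⟩ : D s / 2 ∈ Icc (D t) (D s))
    have hxs : x ≠ s := by
      rintro rfl
      linarith
    linarith [hafter x ⟨lt_of_le_of_ne hx.1 hxs.symm, hx.2⟩]
  have hds := hzero s ⟨hs.1, hst.trans_le ht.2⟩ hzs
  obtain ⟨ε, hε, hball⟩ := Metric.continuousWithinAt_iff.1 (hd s hs1) (d s) hds
  set x := min t (s + ε / 2) with hx
  have hsx : s < x := lt_min hst (by linarith)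
  have hxt : x ≤ t := min_le_left _ _
  have hmono : StrictMonoOn D (Icc s x) := by
    refine strictMonoOn_of_deriv_pos (convex_Icc s x)
      (hD.mono ((Icc_subset_Icc le_rfl hxt).trans hsub)) fun y hy => ?_
    rw [interior_Icc] at hy
    have hy' : y ∈ Ioo a b := ⟨hs.1.trans_lt hy.1, hy.2.trans_le (hxt.trans ht.2)⟩
    rw [(hderiv y hy').deriv]
    have h1 : dist y s < ε := by
      rw [Real.dist_eq, abs_of_pos (sub_pos.2 hy.1)]
      linarith [hy.2, min_le_right t (s + ε / 2)]
    have h2 := hball (Ioo_subset_Icc_self hy') h1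
    rw [Real.dist_eq] at h2
    linarith [neg_abs_le (d y - d s)]
  have := hmono (left_mem_Icc.2 hsx.le) (right_mem_Icc.2 hsx.le) hsx
  linarith [hafter x ⟨hsx, hxt⟩]

namespace PolarArc

variable {ρ ξ : ℝ → ℝ} {a b : ℝ}

/-- More than a quarter turn separates a point at minimal distance from the next point at maximal
distance. -/
theorem pi_div_two_lt (h : PolarArc ρ ξ a b) (hab : a < b) (hpos : ∀ t ∈ Ioo a b, 0 < ξ t)
    (ha : ξ a = 0) (hb : ξ b = 0) : π / 2 < b - a := by
  by_contra! hle
  set k := fun t => exp (ρ t) * cos (ξ t) with hk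
  set u := fun t => exp (ρ t) * sin (ξ t) with hu
  have ck : ContinuousOn k (Icc a b) := h.contCos
  have cu : ContinuousOn u (Icc a b) := h.contSin
  have cχ : ContinuousOn (fun t => 2 * (t - ξ t - a)) (Icc a b) :=
    continuousOn_const.mul ((continuousOn_id.sub h.contXi).sub continuousOn_const)
  have hmono := h.angle_strictMonoOn
  -- The Wronskian of `f = (k²)' = 2ku` with `sin 2χ`, where `χ` is the turning since `a`: here `f''
  -- + 4f = 4u/k > 0`. It vanishes at `a`, and at `b` it is `(2 - 2k²) sin (2(b - a)) ≤ 0` because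
  -- `k = exp ρ ≥ 1` there.
  have hS : StrictMonoOn (fun t => (2 * u t ^ 2 + 2 - 2 * k t ^ 2) * sin (2 * (t - ξ t - a))
      - 4 * u t * k t * cos (2 * (t - ξ t - a))) (Icc a b) := by
    refine strictMonoOn_of_deriv_pos (convex_Icc a b) ?_ fun t ht => ?_
    · exact ((((continuousOn_const.mul (cu.pow 2)).add continuousOn_const).sub
        (continuousOn_const.mul (ck.pow 2))).mul (continuous_sin.comp_continuousOn cχ)).sub
        (((continuousOn_const.mul cu).mul ck).mul (continuous_cos.comp_continuousOn cχ))
    · rw [interior_Icc] at ht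
      have hk0 : 0 < k t := mul_pos (exp_pos _) (h.cos_pos (Ioo_subset_Icc_self ht))
      have hbd := h.bound t (Ioo_subset_Icc_self ht)
      have hu0 : 0 < u t := mul_pos (exp_pos _)
        (sin_pos_of_pos_of_lt_pi (hpos t ht) (by linarith [hbd.2, pi_pos]))
      have dk : HasDerivAt k (exp (ρ t) ^ 2 * u t) t := h.derivCos ht
      have du : HasDerivAt u (exp (ρ t) ^ 2 * ((k t)⁻¹ - k t)) t := h.derivSin ht
      have dχ := ((h.derivAngle ht).sub_const a).const_mul 2
      have dS := ((((du.pow 2).const_mul 2).add_const 2).sub ((dk.pow 2).const_mul 2)).mul dχ.sin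
        |>.sub (((du.const_mul 4).mul dk).mul dχ.cos)
      have key : HasDerivAt (fun t => (2 * u t ^ 2 + 2 - 2 * k t ^ 2) * sin (2 * (t - ξ t - a))
          - 4 * u t * k t * cos (2 * (t - ξ t - a)))
          (exp (ρ t) ^ 2 * (4 * u t / k t * sin (2 * (t - ξ t - a)))) t := by
        refine dS.congr_deriv ?_
        simp only [Pi.sub_apply, Pi.pow_apply, Pi.mul_apply]
        field_simp
        ring
      rw [key.deriv]
      have h1 := hmono (left_mem_Icc.2 hab.le) (Ioo_subset_Icc_self ht) ht.1
      have h2 := hmono (Ioo_subset_Icc_self ht) (right_mem_Icc.2 hab.le) ht.2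
      simp only [ha, hb, sub_zero] at h1 h2
      have : 0 < sin (2 * (t - ξ t - a)) :=
        sin_pos_of_pos_of_lt_pi (by linarith) (by linarith)
      positivity
  have h1 := hS (left_mem_Icc.2 hab.le) (right_mem_Icc.2 hab.le) hab
  have h2 := h.rho_nonneg_of_top hab hpos hb
  have h3 : (1 : ℝ) ≤ exp (ρ b) := one_le_exp h2
  simp only [hk, hu, ha, hb, sin_zero, cos_zero, mul_zero, sub_zero, sub_self, zero_mul, mul_one]
    at h1
  have h4 : 0 ≤ sin (2 * (b - a)) := sin_nonneg_of_nonneg_of_le_pi (by linarith) (by linarith)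
  nlinarith [mul_nonneg (sub_nonneg.2 (one_le_pow₀ h3 (n := 2))) h4]

/-- Starting from a point at minimal distance, a shrinking arc leaves the unit disk within a quarter
turn. -/
theorem sub_le_pi_div_two (h : PolarArc ρ ξ a b) (hab : a < b) (hpos : ∀ t ∈ Ioc a b, 0 < ξ t)
    (ha : ξ a = 0) (hb : ρ b ≤ 0) : b - a ≤ π / 2 := by
  by_contra! hlt
  -- Truncation at `a + π` keeps the sine of the turning positive.
  obtain ⟨c, hac, hcb, hc1, hc2⟩ : ∃ c, a < c ∧ c ≤ b ∧ π / 2 < c - a ∧ c - a ≤ π :=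
    ⟨min b (a + π), lt_min hab (by linarith [pi_pos]), min_le_left _ _, by
      rcases min_choice b (a + π) with h | h <;> rw [h] <;> linarith [pi_pos], by
      linarith [min_le_right b (a + π)]⟩
  have hρc : ρ c ≤ 0 := ((h.rho_strictMonoOn fun t ht => hpos t ⟨ht.1, ht.2.le⟩).monotoneOn
    ⟨hac.le, hcb⟩ (right_mem_Icc.2 hab.le) hcb).trans hb
  replace h := h.sub le_rfl hcb
  replace hpos : ∀ t ∈ Ioc a c, 0 < ξ t := fun t ht => hpos t ⟨ht.1, ht.2.trans hcb⟩
  set k := fun t => exp (ρ t) * cos (ξ t) with hk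
  set u := fun t => exp (ρ t) * sin (ξ t) with hu
  have ck : ContinuousOn k (Icc a c) := h.contCos
  have cu : ContinuousOn u (Icc a c) := h.contSin
  have hk0 : ∀ t ∈ Icc a c, 0 < k t := fun t ht => mul_pos (exp_pos _) (h.cos_pos ht)
  have hu0 : ∀ t ∈ Ioc a c, 0 < u t := fun t ht => mul_pos (exp_pos _) (sin_pos_of_pos_of_lt_pi
    (hpos t ht) (by linarith [(h.bound t ⟨ht.1.le, ht.2⟩).2, pi_pos]))
  have cχ : ContinuousOn (fun t => t - ξ t - a) (Icc a c) :=
    (continuousOn_id.sub h.contXi).sub continuousOn_const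
  have hmono := h.angle_strictMonoOn
  -- The Wronskian of `u` with `sin χ`, where `u'' + u = -u/k²`; it vanishes at `a`.
  have hS : AntitoneOn (fun t => ((k t)⁻¹ - k t) * sin (t - ξ t - a) - u t * cos (t - ξ t - a))
      (Icc a c) := by
    have key : ∀ t ∈ Ioo a c, HasDerivAt
        (fun t => ((k t)⁻¹ - k t) * sin (t - ξ t - a) - u t * cos (t - ξ t - a))
        (-(exp (ρ t) ^ 2 * (u t / k t ^ 2 * sin (t - ξ t - a)))) t := by
      intro t ht
      have hk1 := (hk0 t (Ioo_subset_Icc_self ht)).ne'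
      have dk : HasDerivAt k (exp (ρ t) ^ 2 * u t) t := h.derivCos ht
      have du : HasDerivAt u (exp (ρ t) ^ 2 * ((k t)⁻¹ - k t)) t := h.derivSin ht
      have dχ := (h.derivAngle ht).sub_const a
      refine (((dk.inv hk1).sub dk).mul dχ.sin |>.sub (du.mul dχ.cos)).congr_deriv ?_
      simp only [Pi.sub_apply, Pi.inv_apply]
      field_simp
      ring
    refine antitoneOn_of_deriv_nonpos (convex_Icc a c) ?_ (fun t ht => ?_) fun t ht => ?_
    · exact (((ck.inv₀ fun t ht => (hk0 t ht).ne').sub ck).mul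
        (continuous_sin.comp_continuousOn cχ)).sub (cu.mul (continuous_cos.comp_continuousOn cχ))
    · rw [interior_Icc] at ht
      exact (key t ht).differentiableAt.differentiableWithinAt
    · rw [interior_Icc] at ht
      rw [(key t ht).deriv]
      have h1 := hmono (left_mem_Icc.2 hac.le) (Ioo_subset_Icc_self ht) ht.1
      simp only [ha, sub_zero] at h1
      have : 0 < sin (t - ξ t - a) := sin_pos_of_pos_of_lt_pi (by linarith)
        (by linarith [hpos t ⟨ht.1, ht.2.le⟩, ht.2])
      have := hu0 t ⟨ht.1, ht.2.le⟩
      have := hk0 t (Ioo_subset_Icc_self ht)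
      rw [neg_nonpos]
      positivity
  have hc : c ∈ Icc a c := right_mem_Icc.2 hac.le
  have h1 := hS (left_mem_Icc.2 hac.le) hc hac.le
  simp only [ha, sub_zero, sub_self, sin_zero, mul_zero, hu, cos_zero, mul_one] at h1
  have hkc := hk0 c hc
  have huc := hu0 c ⟨hac, le_rfl⟩
  have h2 := hmono (left_mem_Icc.2 hac.le) hc hac
  simp only [ha, sub_zero] at h2
  have hsin : 0 < sin (c - ξ c - a) := sin_pos_of_pos_of_lt_pi (by linarith)
    (by linarith [hpos c ⟨hac, le_rfl⟩])
  have h3 : k c ^ 2 + u c ^ 2 ≤ 1 := by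
    have : k c ^ 2 + u c ^ 2 = exp (ρ c) ^ 2 := by
      simp only [hk, hu]
      linear_combination exp (ρ c) ^ 2 * sin_sq_add_cos_sq (ξ c)
    rw [this]
    exact pow_le_one₀ (exp_pos _).le (exp_le_one_iff.2 hρc)
  have h4 : u c ^ 2 ≤ k c * ((k c)⁻¹ - k c) := by
    rw [mul_sub, mul_inv_cancel₀ hkc.ne']
    nlinarith
  -- Inside the unit disk `u² ≤ 1 - k² = k (1/k - k)`. Together with the Wronskian inequality this
  -- gives `u sin χ ≤ k cos χ`, that is `cos (ξ + χ) ≥ 0`, and `ξ + χ = c - a`.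
  have h5 : u c * (u c * sin (c - ξ c - a)) ≤ u c * (k c * cos (c - ξ c - a)) := by
    nlinarith [mul_le_mul_of_nonneg_right h4 hsin.le, mul_le_mul_of_nonneg_left h1 hkc.le]
  have h6 := le_of_mul_le_mul_left h5 huc
  have h7 : 0 ≤ exp (ρ c) * cos (c - a) := by
    rw [show c - a = ξ c + (c - ξ c - a) by ring, cos_add]
    simp only [hk, hu] at h6
    linarith
  have h8 : cos (c - a) < 0 := cos_neg_of_pi_div_two_lt_of_lt hc1 (by linarith [pi_pos])
  have := mul_neg_of_pos_of_neg (exp_pos (ρ c)) h8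
  linarith

theorem exists_strictAntiOn (h : PolarArc ρ ξ a b) {t : ℝ} (ht : t ∈ Ioo a b) (hρ : 0 < ρ t) :
    ∃ δ > 0, Icc (t - δ) (t + δ) ⊆ Ioo a b ∧ StrictAntiOn ξ (Icc (t - δ) (t + δ)) := by
  have hcont := h.contRho.continuousAt (Icc_mem_nhds ht.1 ht.2)
  obtain ⟨δ, hδ, hball⟩ := (nhds_basis_Icc_pos t).mem_iff.1
    (Filter.inter_mem (hcont.eventually (lt_mem_nhds hρ)) (Ioo_mem_nhds ht.1 ht.2))
  have h1 : a ≤ t - δ := (hball (left_mem_Icc.2 (by linarith))).2.1.le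
  have h2 : t + δ ≤ b := (hball (right_mem_Icc.2 (by linarith))).2.2.le
  exact ⟨δ, hδ, fun x hx => (hball hx).2,
    (h.sub h1 h2).xi_strictAntiOn fun x hx => (hball (Ioo_subset_Icc_self hx)).1⟩

theorem exists_strictMonoOn (h : PolarArc ρ ξ a b) {t : ℝ} (ht : t ∈ Ioo a b) (hρ : ρ t < 0) :
    ∃ δ > 0, Icc (t - δ) (t + δ) ⊆ Ioo a b ∧ StrictMonoOn ξ (Icc (t - δ) (t + δ)) := by
  have hcont := h.contRho.continuousAt (Icc_mem_nhds ht.1 ht.2)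
  obtain ⟨δ, hδ, hball⟩ := (nhds_basis_Icc_pos t).mem_iff.1
    (Filter.inter_mem (hcont.eventually (gt_mem_nhds hρ)) (Ioo_mem_nhds ht.1 ht.2))
  have h1 : a ≤ t - δ := (hball (left_mem_Icc.2 (by linarith))).2.1.le
  have h2 : t + δ ≤ b := (hball (right_mem_Icc.2 (by linarith))).2.2.le
  exact ⟨δ, hδ, fun x hx => (hball hx).2,
    (h.sub h1 h2).xi_strictMonoOn fun x hx => (hball (Ioo_subset_Icc_self hx)).1⟩

/-- The first zero of `ξ`, on an arc that starts with `ξ > 0`. -/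
theorem exists_first_top (h : PolarArc ρ ξ a b) (hab : a ≤ b) (ha : 0 < ξ a) (hb : ξ b ≤ 0) :
    ∃ t ∈ Ioc a b, ξ t = 0 ∧ (∀ s ∈ Ico a t, 0 < ξ s) ∧ 0 < ρ t := by
  obtain ⟨t, ht, ht0, hpos⟩ := exists_first_nonpos hab h.contXi ha hb
  have h1 := (h.sub le_rfl ht.2).rho_nonneg_of_top ht.1 (fun s hs => hpos s ⟨hs.1.le, hs.2⟩) ht0
  exact ⟨t, ht, ht0, hpos, lt_of_le_of_ne h1 (h.rho_ne_zero (left_mem_Icc.2 hab)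
    ⟨ht.1.le, ht.2⟩ ha.ne' ht0).symm⟩

/-- The last zero of `ξ`, on an arc that ends with `ξ < 0`. -/
theorem exists_last_top (h : PolarArc ρ ξ a b) (hab : a ≤ b) (ha : 0 ≤ ξ a) (hb : ξ b < 0) :
    ∃ t ∈ Ico a b, ξ t = 0 ∧ (∀ s ∈ Ioc t b, ξ s < 0) ∧ 0 < ρ t := by
  obtain ⟨t, ht, ht0, hpos, hρ⟩ := (h.reflect (a + b)).exists_first_top (by linarith)
    (by simpa using hb) (by simpa using ha)
  refine ⟨a + b - t, ⟨by linarith [ht.2], by linarith [ht.1]⟩, by simpa using ht0,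
    fun s hs => ?_, hρ⟩
  have := hpos (a + b - s) ⟨by linarith [hs.2], by linarith [hs.1]⟩
  simpa using this

/-- The first zero of `ξ`, on an arc that starts with `ξ < 0`. -/
theorem exists_first_bottom (h : PolarArc ρ ξ a b) (hab : a ≤ b) (ha : ξ a < 0) (hb : 0 ≤ ξ b) :
    ∃ t ∈ Ioc a b, ξ t = 0 ∧ (∀ s ∈ Ico a t, ξ s < 0) ∧ ρ t < 0 := by
  obtain ⟨t, ht, ht0, hpos⟩ := exists_first_nonpos (f := fun t => -ξ t) hab h.contXi.neg
    (by simpa using ha) (by simpa using hb)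
  simp only [Left.neg_pos_iff, neg_eq_zero] at ht0 hpos
  have h1 := ((h.sub le_rfl ht.2).reflect (a + t)).rho_nonpos_of_bottom (by linarith [ht.1])
    (fun s hs => by
      simpa using hpos (a + t - s) ⟨by linarith [hs.2], by linarith [hs.1]⟩) (by simpa using ht0)
  simp only [add_sub_cancel_right, add_sub_cancel_left] at h1
  exact ⟨t, ht, ht0, hpos, lt_of_le_of_ne h1 (h.rho_ne_zero (left_mem_Icc.2 hab)
    ⟨ht.1.le, ht.2⟩ ha.ne ht0)⟩

/-- An arc that starts with `ξ > 0` and ends with `ξ < 0` has either a single point at extremal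
distance, or a point at minimal distance between its first and its last point at maximal
distance. -/
theorem single_top_or_bottom (h : PolarArc ρ ξ a b) (hab : a < b) (ha : 0 < ξ a) (hb : ξ b < 0) :
    (∃ t ∈ Ioo a b, ξ t = 0 ∧ (∀ s ∈ Ico a t, 0 < ξ s) ∧ ∀ s ∈ Ioc t b, ξ s < 0) ∨
    ∃ t₁ t t₂, a < t₁ ∧ t₁ < t ∧ t < t₂ ∧ t₂ < b ∧ π < t₂ - t₁ ∧ (ξ t = 0 ∧ ρ t < 0) ∧
      (ξ t₁ = 0 ∧ 0 < ρ t₁ ∧ ∀ s ∈ Ico a t₁, 0 < ξ s) ∧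
      (ξ t₂ = 0 ∧ 0 < ρ t₂ ∧ ∀ s ∈ Ioc t₂ b, ξ s < 0) := by
  obtain ⟨t₁, h₁, z₁, p₁, ρ₁⟩ := h.exists_first_top hab.le ha hb.le
  obtain ⟨t₂, h₂, z₂, p₂, ρ₂⟩ := h.exists_last_top hab.le ha.le hb
  have h₁b : t₁ < b := lt_of_le_of_ne h₁.2 fun e => by rw [← e, z₁] at hb; exact lt_irrefl _ hb
  have h₂a : a < t₂ := lt_of_le_of_ne h₂.1 fun e => by rw [e, z₂] at ha; exact lt_irrefl _ ha
  have hle : t₁ ≤ t₂ := by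
    by_contra! hlt
    exact (p₁ t₂ ⟨h₂.1, hlt⟩).ne' z₂
  rcases hle.eq_or_lt with rfl | hlt
  · exact Or.inl ⟨t₁, ⟨h₁.1, h₁b⟩, z₁, p₁, p₂⟩
  refine Or.inr ?_
  -- Outside the unit disk `ξ` decreases, so it is negative just after `t₁` and positive just before
  -- `t₂`, with a minimum `t` of the distance between. More than `π / 2` separates `t` from `t₁`,
  -- and also from the next maximum `t₃ ≤ t₂`.
  obtain ⟨δ₁, hδ₁, hs₁, m₁⟩ := h.exists_strictAntiOn ⟨h₁.1, h₁b⟩ ρ₁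
  obtain ⟨δ₂, hδ₂, hs₂, m₂⟩ := h.exists_strictAntiOn ⟨h₂a, h₂.2⟩ ρ₂
  have neg₁ : ∀ s ∈ Ioc t₁ (t₁ + δ₁), ξ s < 0 := fun s hs => by
    rw [← z₁]
    exact m₁ ⟨by linarith, by linarith⟩ ⟨by linarith [hs.1], hs.2⟩ hs.1
  have pos₂ : ∀ s ∈ Ico (t₂ - δ₂) t₂, 0 < ξ s := fun s hs => by
    rw [← z₂]
    exact m₂ ⟨hs.1, by linarith [hs.2]⟩ ⟨by linarith, by linarith⟩ hs.2
  set m := (t₁ + t₂) / 2 with hm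
  obtain ⟨s₁, hs1, hs1'⟩ : ∃ s₁, t₁ < s₁ ∧ s₁ ≤ min (t₁ + δ₁) m :=
    ⟨min (t₁ + δ₁) m, lt_min (by linarith) (by linarith), le_rfl⟩
  obtain ⟨s₂, hs2, hs2'⟩ : ∃ s₂, s₂ < t₂ ∧ max (t₂ - δ₂) m ≤ s₂ :=
    ⟨max (t₂ - δ₂) m, max_lt (by linarith) (by linarith), le_rfl⟩
  have e1 := hs1'.trans (min_le_left _ _)
  have e2 := hs1'.trans (min_le_right _ _)
  have e3 := (le_max_left _ _).trans hs2'
  have e4 := (le_max_right _ _).trans hs2'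
  obtain ⟨t, ht, zt, nt, ρt⟩ := (h.sub (h₁.1.le.trans hs1.le) (hs2.le.trans h₂.2.le)).exists_first_bottom
    (e2.trans e4) (neg₁ s₁ ⟨hs1, e1⟩) (pos₂ s₂ ⟨e3, hs2⟩).le
  have ht1 : t₁ < t := hs1.trans ht.1
  have ht2 : t < t₂ := ht.2.trans_lt hs2
  have hneg : ∀ s ∈ Ioo t₁ t, ξ s < 0 := fun s hs => by
    rcases le_or_gt s s₁ with h3 | h3
    · exact neg₁ s ⟨hs.1, h3.trans e1⟩
    · exact nt s ⟨h3.le, hs.2⟩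
  have gap₁ := ((h.sub h₁.1.le (ht2.trans h₂.2).le).reflect (t₁ + t)).pi_div_two_lt (by linarith)
    (fun s hs => by
      simpa using hneg (t₁ + t - s) ⟨by linarith [hs.2], by linarith [hs.1]⟩)
    (by simpa using zt) (by simpa using z₁)
  obtain ⟨δ, hδ, hs, mt⟩ := h.exists_strictMonoOn ⟨h₁.1.trans ht1, ht2.trans h₂.2⟩ ρt
  obtain ⟨s₃, hs3, hs3'⟩ : ∃ s₃, t < s₃ ∧ s₃ ≤ min (t + δ) t₂ :=
    ⟨min (t + δ) t₂, lt_min (by linarith) ht2, le_rfl⟩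
  have e5 := hs3'.trans (min_le_left _ _)
  have e6 := hs3'.trans (min_le_right _ _)
  have pos₃ : ∀ s ∈ Ioc t s₃, 0 < ξ s := fun s hs => by
    rw [← zt]
    exact mt ⟨by linarith, by linarith⟩ ⟨by linarith [hs.1], hs.2.trans e5⟩ hs.1
  obtain ⟨t₃, h₃, z₃, p₃, -⟩ := (h.sub ((h₁.1.trans ht1).trans hs3).le h₂.2.le).exists_first_top e6
    (pos₃ s₃ ⟨hs3, le_rfl⟩) z₂.le
  have gap₂ := (h.sub (h₁.1.trans ht1).le (h₃.2.trans h₂.2.le)).pi_div_two_lt (hs3.trans h₃.1)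
    (fun s hs => by
      rcases le_or_gt s s₃ with h3 | h3
      · exact pos₃ s ⟨hs.1, h3⟩
      · exact p₃ s ⟨h3.le, hs.2⟩) zt z₃
  exact ⟨t₁, t, t₂, h₁.1, ht1, ht2, h₂.2, by linarith [h₃.2], ⟨zt, ρt⟩, ⟨z₁, ρ₁, p₁⟩, ⟨z₂, ρ₂, p₂⟩⟩

end PolarArc
end ThetaShrinker

/-! ### Exclusion of the two configurations in polar form. -/

namespace ThetaShrinker
open Real

/-- The tangent turns by `π + π/3 = 4π/3`. A single maximum would split this into two parts, each
less than `2π / 3`; more extrema need a polar angle larger than `π`. -/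
theorem PolarArc.not_line {ρ ξ : ℝ → ℝ} (h : PolarArc ρ ξ 0 π) (h₀ : ξ 0 = π / 6)
    (h₁ : ξ π = -(π / 6)) : False := by
  have hpi := pi_pos
  rcases h.single_top_or_bottom hpi (by linarith) (by linarith) with
    ⟨t, ht, zt, p, n⟩ | ⟨t₁, t, t₂, h1, -, -, h2, h3, -⟩
  · have b₁ := (h.sub le_rfl ht.2.le).angle_to_top_lt ht.1 p zt h₀.ge
    have b₂ := ((h.sub ht.1.le le_rfl).reflect π).angle_to_top_lt (by linarith [ht.2])
      (fun s hs => by simpa using n (π - s) ⟨by linarith [hs.2], by linarith [hs.1]⟩)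
      (by simpa using zt) (by simp [h₁])
    simp only [sub_self, sub_zero, h₁] at b₂
    linarith
  · linarith

/-- Three shrinking arcs in polar form that bound two regions and meet at the angle `2π / 3`: the
arcs with index `m` and `p` run counterclockwise around the origin through the angle `Φ`, the first
of them inside the second one, and the arc with index `q` runs clockwise through the complementary
angle. The data for `q` are those of its mirror image. -/
structure PolarTheta (ρp ξp ρm ξm ρq ξq : ℝ → ℝ) (Φ : ℝ) : Prop where
  pos : 0 < Φ
  lt_two_pi : Φ < 2 * π
  arc_p : PolarArc ρp ξp 0 Φ
  arc_m : PolarArc ρm ξm 0 Φ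
  arc_q : PolarArc ρq ξq 0 (2 * π - Φ)
  m_left : ρm 0 = ρp 0
  m_right : ρm Φ = ρp Φ
  q_left : ρq 0 = ρp 0
  q_right : ρq (2 * π - Φ) = ρp Φ
  inside : ∀ t ∈ Ioo 0 Φ, ρm t < ρp t
  angle_m_left : ξp 0 - ξm 0 = 2 * π / 3
  angle_m_right : ξp Φ - ξm Φ = -(2 * π / 3)
  angle_q_left : ξq 0 = π / 3 - ξp 0
  angle_q_right : ξq (2 * π - Φ) = -(π / 3) - ξp Φ

/-- The radial part `x - exp (2x) / 2` of the first integral decreases outside the unit circle and,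
by the next lemma, increases inside. -/
theorem half_exp_sub_lt_of_nonneg {x y : ℝ} (hx : 0 ≤ x) (hxy : x < y) :
    y - exp (2 * y) / 2 < x - exp (2 * x) / 2 := by
  have h1 := add_one_lt_exp (x := 2 * (y - x)) (by linarith)
  have h2 : (1 : ℝ) ≤ exp (2 * x) := one_le_exp (by linarith)
  have h3 : exp (2 * y) = exp (2 * x) * exp (2 * (y - x)) := by rw [← exp_add]; ring_nf
  nlinarith

theorem half_exp_sub_lt_of_nonpos {x y : ℝ} (hy : y ≤ 0) (hxy : x < y) :
    x - exp (2 * x) / 2 < y - exp (2 * y) / 2 := by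
  have h1 := add_one_lt_exp (x := 2 * (x - y)) (by linarith)
  have h2 : exp (2 * y) ≤ 1 := exp_le_one_iff.2 (by linarith)
  have h3 : exp (2 * x) = exp (2 * y) * exp (2 * (x - y)) := by rw [← exp_add]; ring_nf
  have h4 := exp_pos (2 * y)
  nlinarith

theorem abs_lt_abs_of_cos_lt {x y : ℝ} (hx : x ∈ Ioo (-(π / 2)) (π / 2))
    (hy : y ∈ Ioo (-(π / 2)) (π / 2)) (h : cos x < cos y) : |y| < |x| := by
  have hx' := abs_lt.2 hx
  have hy' := abs_lt.2 hy
  rw [← cos_abs x, ← cos_abs y] at h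
  exact (strictAntiOn_cos.lt_iff_gt ⟨abs_nonneg _, by linarith [pi_pos]⟩
    ⟨abs_nonneg _, by linarith [pi_pos]⟩).1 h

theorem slope_eq {ρ ξ : ℝ} (h₀ : 0 < ξ) (h₁ : ξ < π / 2) :
    slope ρ ξ = tan ξ / 3 + (exp ρ ^ 2)⁻¹ * (tan ξ + (tan ξ)⁻¹) - (tan ξ)⁻¹ := by
  have hc := (cos_pos_of_mem_Ioo ⟨by linarith, h₁⟩).ne'
  have hs := (sin_pos_of_pos_of_lt_pi h₀ (by linarith)).ne'
  have he := (exp_pos ρ).ne'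
  rw [slope, tan_eq_sin_div_cos]
  field_simp
  linear_combination -3 * sin_sq_add_cos_sq ξ

/-- Comparison of the outgoing slopes of two arcs that leave a point outside the unit disk. -/
theorem lt_arctan_slope_sub {ρ x : ℝ} (hρ : 0 ≤ ρ) (hx : π / 6 < x) (hx' : x < π / 3) :
    π * (1 - 2 * √2 / 3) < arctan (slope ρ (2 * π / 3 - x) / √2)
      - arctan (slope ρ (π / 3 - x) / √2) := by
  have hpi := pi_gt_three
  set R := (exp ρ ^ 2)⁻¹ with hR
  have hR0 : 0 < R := by positivity
  have hR1 : R ≤ 1 := inv_le_one_of_one_le₀ (one_le_pow₀ (one_le_exp hρ))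
  rw [slope_eq (by linarith) (by linarith), slope_eq (by linarith) (by linarith), ← hR]
  set t := tan (2 * π / 3 - x) with ht
  set s := tan (π / 3 - x) with hs
  have ht0 : 0 < t := tan_pos_of_pos_of_lt_pi_div_two (by linarith) (by linarith)
  have hs0 : 0 < s := tan_pos_of_pos_of_lt_pi_div_two (by linarith) (by linarith)
  -- Subtraction formula for the tangent: the two angles differ by `π / 3`.
  have hts : t - s = √3 * (1 + t * s) := by
    have hc := (cos_pos_of_mem_Ioo (x := 2 * π / 3 - x) ⟨by linarith, by linarith⟩).ne'
    have hc' := (cos_pos_of_mem_Ioo (x := π / 3 - x) ⟨by linarith, by linarith⟩).ne'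
    have h1 := sin_sub (2 * π / 3 - x) (π / 3 - x)
    have h2 := cos_sub (2 * π / 3 - x) (π / 3 - x)
    rw [show 2 * π / 3 - x - (π / 3 - x) = π / 3 by ring] at h1 h2
    rw [sin_pi_div_three] at h1
    rw [cos_pi_div_three] at h2
    rw [ht, hs, tan_eq_sin_div_cos, tan_eq_sin_div_cos]
    generalize 2 * π / 3 - x = y at *
    generalize π / 3 - x = y' at *
    field_simp
    linear_combination √3 * h2 - h1
  have h3 : √3 ^ 2 = 3 := sq_sqrt zero_le_three
  have h3' : 1.73 < √3 := lt_sqrt_of_sq_lt (by norm_num)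
  have h2 : √2 ^ 2 = 2 := sq_sqrt zero_le_two
  have h2' : 1.414 < √2 := lt_sqrt_of_sq_lt (by norm_num)
  have h2'' : √2 < 1.415 := by nlinarith
  have hts0 := mul_pos ht0 hs0
  have htge : √3 ≤ t := by nlinarith
  have hsle : √3 * s ≤ 1 := by
    by_contra! h
    nlinarith
  have hsle' : s ≤ 0.5781 := by nlinarith
  set wm := t / 3 + R * (t + t⁻¹) - t⁻¹ with hwm
  set wq := s / 3 + R * (s + s⁻¹) - s⁻¹ with hwq
  have hinv : s⁻¹ - t⁻¹ = √3 * (1 + (t * s)⁻¹) := by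
    have : s⁻¹ - t⁻¹ = (t - s) * (t * s)⁻¹ := by field_simp
    rw [this, hts]
    field_simp
    ring
  have hG : √3 ≤ s⁻¹ - t⁻¹ := by
    rw [hinv]
    have : 0 < (t * s)⁻¹ := by positivity
    nlinarith
  have hΔ : √3 ≤ t - s := by nlinarith
  -- The three terms add up to at least `4√3 / 3`, whatever `R ∈ (0, 1]` is.
  have hdiff : 2.3 ≤ wm - wq := by
    have : wm - wq = (t - s) / 3 + (1 - R) * (s⁻¹ - t⁻¹) + R * (t - s) := by
      rw [hwm, hwq]
      ring
    nlinarith [mul_le_mul_of_nonneg_left hG (sub_nonneg.2 hR1),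
      mul_le_mul_of_nonneg_left hΔ hR0.le]
  have hm : 0 ≤ wm := by
    have h4 : t⁻¹ ≤ t / 3 := by
      rw [inv_eq_one_div, div_le_div_iff₀ ht0 three_pos]
      nlinarith
    have : 0 ≤ R * (t + t⁻¹) := by positivity
    linarith
  have hq : wq ≤ 0.7708 := by
    have : R * (s + s⁻¹) ≤ 1 * (s + s⁻¹) := by gcongr
    linarith
  have hs2 : (0 : ℝ) < √2 := by positivity
  have hgoal : π * (1 - 2 * √2 / 3) ≤ 0.181 := by
    have h4 : π * (1 - 2 * √2 / 3) ≤ 3.15 * (1 - 2 * √2 / 3) :=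
      mul_le_mul_of_nonneg_right pi_lt_d2.le (by linarith)
    linarith
  -- Either `arctan (wq / √2)` alone is negative enough, or `wm ≥ 1.9 > √2` gives at least `π / 4`
  -- against at most `0.55`.
  rcases le_total wq (-0.4) with hcase | hcase
  · have h4 : 0 ≤ arctan (wm / √2) := arctan_nonneg.2 (by positivity)
    have h5 : arctan (wq / √2) ≤ arctan (-(0.28)) :=
      arctan_mono (by rw [div_le_iff₀ hs2]; linarith)
    rw [arctan_neg] at h5
    have h6 := div_one_add_sq_le_arctan (x := 0.28) (by norm_num)
    norm_num at h6
    norm_num at h5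
    linarith
  · have h4 : arctan 1 ≤ arctan (wm / √2) :=
      arctan_mono (by rw [le_div_iff₀ hs2]; linarith)
    have h5 : arctan (wq / √2) ≤ arctan 0.55 :=
      arctan_mono (by rw [div_le_iff₀ hs2]; linarith)
    have h6 : arctan 0.55 ≤ 0.55 := by
      have := le_tan (arctan_nonneg.2 (by norm_num : (0 : ℝ) ≤ 0.55)) (arctan_lt_pi_div_two _)
      rwa [tan_arctan] at this
    rw [arctan_one] at h4
    linarith

namespace PolarTheta

variable {ρp ξp ρm ξm ρq ξq : ℝ → ℝ} {Φ : ℝ}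

theorem reflect (h : PolarTheta ρp ξp ρm ξm ρq ξq Φ) :
    PolarTheta (fun t => ρp (Φ - t)) (fun t => -ξp (Φ - t)) (fun t => ρm (Φ - t))
      (fun t => -ξm (Φ - t)) (fun t => ρq (2 * π - Φ - t)) (fun t => -ξq (2 * π - Φ - t)) Φ where
  pos := h.pos
  lt_two_pi := h.lt_two_pi
  arc_p := by simpa using h.arc_p.reflect Φ
  arc_m := by simpa using h.arc_m.reflect Φ
  arc_q := by simpa using h.arc_q.reflect (2 * π - Φ)
  m_left := by simpa using h.m_right
  m_right := by simpa using h.m_left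
  q_left := by simpa using h.q_right
  q_right := by simpa using h.q_left
  inside t ht := h.inside (Φ - t) ⟨by linarith [ht.2], by linarith [ht.1]⟩
  angle_m_left := by simp only [sub_zero]; linarith [h.angle_m_right]
  angle_m_right := by simp only [sub_self]; linarith [h.angle_m_left]
  angle_q_left := by simp only [sub_zero]; linarith [h.angle_q_right]
  angle_q_right := by simp only [sub_self]; linarith [h.angle_q_left]

theorem left_mem (h : PolarTheta ρp ξp ρm ξm ρq ξq Φ) : (0 : ℝ) ∈ Icc 0 Φ :=
  left_mem_Icc.2 h.pos.le

theorem right_mem (h : PolarTheta ρp ξp ρm ξm ρq ξq Φ) : Φ ∈ Icc 0 Φ :=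
  right_mem_Icc.2 h.pos.le

theorem pi_div_six_lt_left (h : PolarTheta ρp ξp ρm ξm ρq ξq Φ) : π / 6 < ξp 0 := by
  linarith [(h.arc_m.bound 0 h.left_mem).1, h.angle_m_left]

theorem right_lt_neg_pi_div_six (h : PolarTheta ρp ξp ρm ξm ρq ξq Φ) : ξp Φ < -(π / 6) := by
  linarith [(h.arc_m.bound Φ h.right_mem).2, h.angle_m_right]

/-- The tangent of the inner arc turns counterclockwise, and the angles at the two junctions add `2
* (2π / 3)` to the turning of the outer one. -/
theorem four_pi_div_three_lt (h : PolarTheta ρp ξp ρm ξm ρq ξq Φ) :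
    4 * π / 3 < Φ + ξp 0 - ξp Φ := by
  have h1 := h.arc_m.angle_strictMonoOn h.left_mem h.right_mem h.pos
  simp only at h1
  linarith [h.angle_m_left, h.angle_m_right]

/-- With a single maximum, `angle_to_top_lt` applied from both ends would make the outer arc turn by
less than `4π / 3`. -/
theorem bottom_of_two_tops (h : PolarTheta ρp ξp ρm ξm ρq ξq Φ) :
    ∃ t₁ t t₂, 0 < t₁ ∧ t₁ < t ∧ t < t₂ ∧ t₂ < Φ ∧ π < t₂ - t₁ ∧ (ξp t = 0 ∧ ρp t < 0) ∧
      (ξp t₁ = 0 ∧ 0 < ρp t₁ ∧ ∀ s ∈ Ico 0 t₁, 0 < ξp s) ∧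
      (ξp t₂ = 0 ∧ 0 < ρp t₂ ∧ ∀ s ∈ Ioc t₂ Φ, ξp s < 0) := by
  have h₀ := h.pi_div_six_lt_left
  have h₁ := h.right_lt_neg_pi_div_six
  have hpi := pi_pos
  rcases h.arc_p.single_top_or_bottom h.pos (by linarith) (by linarith) with
    ⟨t, ht, zt, p, n⟩ | h2
  · have b₁ := (h.arc_p.sub le_rfl ht.2.le).angle_to_top_lt ht.1 p zt h₀.le
    have b₂ := ((h.arc_p.sub ht.1.le le_rfl).reflect Φ).angle_to_top_lt (by linarith [ht.2])
      (fun s hs => by simpa using n (Φ - s) ⟨by linarith [hs.2], by linarith [hs.1]⟩)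
      (by simpa using zt) (by simp only [sub_self, sub_zero]; linarith)
    simp only [sub_self, sub_zero] at b₂
    linarith [h.four_pi_div_three_lt]
  · exact h2

/-- The value of the conserved quantity on the inner arc is smaller than on the outer arc. -/
theorem conserved_lt (h : PolarTheta ρp ξp ρm ξm ρq ξq Φ) {s t : ℝ} (hs : s ∈ Icc 0 Φ)
    (ht : t ∈ Icc 0 Φ) : ρm s - exp (2 * ρm s) / 2 + log (cos (ξm s))
      < ρp t - exp (2 * ρp t) / 2 + log (cos (ξp t)) := by
  -- Comparison at the outer minimum `t₀`, where `ρm < ρp < 0` and `cos ξp = 1`.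
  obtain ⟨t₁, t₀, t₂, h1, h2, h3, h4, -, ⟨z, hρ⟩, -⟩ := h.bottom_of_two_tops
  have h₀ : t₀ ∈ Ioo 0 Φ := ⟨h1.trans h2, h3.trans h4⟩
  have h₀' := Ioo_subset_Icc_self h₀
  rw [h.arc_m.conserved hs h₀', h.arc_p.conserved ht h₀', z, cos_zero, log_one, add_zero]
  have h5 := half_exp_sub_lt_of_nonpos hρ.le (h.inside t₀ h₀)
  have h6 := log_nonpos (h.arc_m.cos_pos h₀').le (cos_le_one (ξm t₀))
  linarith

/-- At equal distances the smaller first integral means the smaller `cos ξ`: the inner arc is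
steeper. -/
theorem abs_lt (h : PolarTheta ρp ξp ρm ξm ρq ξq Φ) {s t : ℝ} (hs : s ∈ Icc 0 Φ)
    (ht : t ∈ Icc 0 Φ) (hst : ρm s = ρp t) : |ξp t| < |ξm s| := by
  have h1 := h.conserved_lt hs ht
  rw [hst] at h1
  exact abs_lt_abs_of_cos_lt (h.arc_m.bound s hs) (h.arc_p.bound t ht)
    ((log_lt_log_iff (h.arc_m.cos_pos hs) (h.arc_p.cos_pos ht)).1 (by linarith))

theorem left_lt (h : PolarTheta ρp ξp ρm ξm ρq ξq Φ) : ξp 0 < π / 3 := by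
  have h1 := h.abs_lt h.left_mem h.left_mem h.m_left
  have h2 := h.pi_div_six_lt_left
  have h3 := (h.arc_p.bound 0 h.left_mem).2
  have h4 := h.angle_m_left
  have := pi_pos
  rw [abs_of_pos (by linarith), abs_of_neg (by linarith)] at h1
  linarith

theorem neg_pi_div_three_lt_right (h : PolarTheta ρp ξp ρm ξm ρq ξq Φ) : -(π / 3) < ξp Φ := by
  have := h.reflect.left_lt
  simp only [sub_zero] at this
  linarith

/-- The inner arc has a single point at extremal distance, which is at minimal distance. -/
theorem exists_bottom (h : PolarTheta ρp ξp ρm ξm ρq ξq Φ) :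
    ∃ φ ∈ Ioo 0 Φ, ξm φ = 0 ∧ ρm φ < 0 ∧ (∀ s ∈ Ico 0 φ, ξm s < 0) ∧ ∀ s ∈ Ioc φ Φ, 0 < ξm s := by
  have h₀ : ξm 0 < 0 := by
    linarith [h.angle_m_left, (h.arc_p.bound 0 h.left_mem).2, pi_pos]
  have h₁ : 0 < ξm Φ := by
    linarith [h.angle_m_right, (h.arc_p.bound Φ h.right_mem).1, pi_pos]
  obtain ⟨φ, hφ, z, n, hρ⟩ := h.arc_m.exists_first_bottom h.pos.le h₀ h₁.le
  have hφ' : φ < Φ := lt_of_le_of_ne hφ.2 fun e => by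
    rw [e] at z
    exact h₁.ne' z
  refine ⟨φ, ⟨hφ.1, hφ'⟩, z, hρ, n, ?_⟩
  by_contra! hcon
  obtain ⟨s, hs, hs0⟩ := hcon
  obtain ⟨δ, hδ, -, mono⟩ := h.arc_m.exists_strictMonoOn ⟨hφ.1, hφ'⟩ hρ
  obtain ⟨c, hc, hc'⟩ : ∃ c, φ < c ∧ c ≤ min (φ + δ) s :=
    ⟨_, lt_min (by linarith) hs.1, le_rfl⟩
  have hpos : 0 < ξm c := by
    rw [← z]
    exact mono ⟨by linarith, by linarith⟩ ⟨by linarith, hc'.trans (min_le_left _ _)⟩ hc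
  have hcs := hc'.trans (min_le_right _ _)
  -- A second zero of `ξm` would produce a maximum of the inner arc outside the unit circle. The
  -- outer arc, still farther out there, would have the smaller first integral, against
  -- `conserved_lt`.
  obtain ⟨t, ht, zt, -, ρt⟩ := (h.arc_m.sub (hφ.1.le.trans hc.le) hs.2).exists_first_top hcs hpos hs0
  have htΦ : t < Φ := lt_of_le_of_ne (ht.2.trans hs.2) fun e => by
    rw [e] at zt
    exact h₁.ne' zt
  have ht' : t ∈ Ioo 0 Φ := ⟨hφ.1.trans (hc.trans ht.1), htΦ⟩
  have h2 := h.conserved_lt (Ioo_subset_Icc_self ht') (Ioo_subset_Icc_self ht')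
  rw [zt, cos_zero, log_one, add_zero] at h2
  have h3 := half_exp_sub_lt_of_nonneg ρt.le (h.inside t ht')
  have h4 := log_nonpos (h.arc_p.cos_pos (Ioo_subset_Icc_self ht')).le (cos_le_one (ξp t))
  linarith

/-- If both junctions were in the unit disk, each half of the inner arc would span at most `π / 2`,
but `Φ > π`. -/
theorem right_pos_of_left_nonpos (h : PolarTheta ρp ξp ρm ξm ρq ξq Φ) (h₀ : ρp 0 ≤ 0) : 0 < ρp Φ := by
  by_contra! h₁
  obtain ⟨φ, hφ, z, -, n, p⟩ := h.exists_bottom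
  obtain ⟨t₁, t₀, t₂, h1, h2, h3, h4, h5, -⟩ := h.bottom_of_two_tops
  have b₁ := (h.arc_m.sub hφ.1.le le_rfl).sub_le_pi_div_two hφ.2 p z (h.m_right.trans_le h₁)
  have b₂ := ((h.arc_m.sub le_rfl hφ.2.le).reflect φ).sub_le_pi_div_two (by linarith [hφ.1])
    (fun s hs => by
      simpa using n (φ - s) ⟨by linarith [hs.2], by linarith [hs.1]⟩)
    (by simpa using z) (by simpa using h.m_left.trans_le h₀)
  linarith

/-- Otherwise the inner arc leaves the unit disk at some `c ≤ π`, so that `c + t₁ < Φ`. Rotate its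
part after `c` back to angle `0`: it starts at least as far out as the outer arc and is steeper
whenever the distances agree, hence `ρm (c + t₁) ≥ ρp t₁`. But `ρp t₁ ≥ ρp Φ = ρm Φ > ρm (c + t₁)`.
-/
theorem left_pos (h : PolarTheta ρp ξp ρm ξm ρq ξq Φ) : 0 < ρp 0 := by
  by_contra! h₀
  have h₁ := h.right_pos_of_left_nonpos h₀
  obtain ⟨φ, hφ, z, ρφ, n, p⟩ := h.exists_bottom
  obtain ⟨t₁, t₀, t₂, h1, h2, h3, h4, h5, -, ⟨z₁, ρ₁, p₁⟩, -⟩ := h.bottom_of_two_tops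
  have b₁ := ((h.arc_m.sub le_rfl hφ.2.le).reflect φ).sub_le_pi_div_two (by linarith [hφ.1])
    (fun s hs => by
      simpa using n (φ - s) ⟨by linarith [hs.2], by linarith [hs.1]⟩)
    (by simpa using z) (by simpa using h.m_left.trans_le h₀)
  have mono_m := (h.arc_m.sub hφ.1.le le_rfl).rho_strictMonoOn fun t ht => p t ⟨ht.1, ht.2.le⟩
  obtain ⟨c, hc, hc0⟩ := intermediate_value_Icc hφ.2.le
    (h.arc_m.contRho.mono (Icc_subset_Icc hφ.1.le le_rfl))
    (⟨ρφ.le, by rw [h.m_right]; exact h₁.le⟩ : (0 : ℝ) ∈ Icc (ρm φ) (ρm Φ))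
  have hφc : φ < c := lt_of_le_of_ne hc.1 fun e => by
    rw [e] at ρφ
    exact ρφ.ne hc0
  have b₂ := (h.arc_m.sub hφ.1.le hc.2).sub_le_pi_div_two hφc
    (fun t ht => p t ⟨ht.1, ht.2.trans hc.2⟩) z hc0.le
  have hlen : t₁ < Φ - c := by linarith
  have hc1 : 0 < c := hφ.1.trans hφc
  have ht1 : t₁ ∈ Icc 0 Φ := ⟨h1.le, by linarith⟩
  have htop : ρp Φ ≤ ρp t₁ := by
    by_contra! hlt
    have h6 := h.arc_p.conserved ht1 h.right_mem
    rw [z₁, cos_zero, log_one, add_zero] at h6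
    have h7 := half_exp_sub_lt_of_nonneg ρ₁.le hlt
    have h8 := log_nonpos (h.arc_p.cos_pos h.right_mem).le (cos_le_one (ξp Φ))
    linarith
  have hshift : MapsTo (fun t => c + t) (Icc 0 t₁) (Icc 0 Φ) := fun t ht =>
    ⟨by linarith [ht.1], by linarith [ht.2]⟩
  have hincl : Icc 0 t₁ ⊆ Icc 0 Φ := Icc_subset_Icc le_rfl ht1.2
  have ctan : ContinuousOn tan (Ioo (-(π / 2)) (π / 2)) := continuousOn_tan_Ioo
  have hcomp := nonneg_of_deriv_pos_at_zeros (D := fun t => ρm (c + t) - ρp t)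
    (d := fun t => tan (ξm (c + t)) - tan (ξp t)) (a := 0) (b := t₁)
    ((h.arc_m.contRho.comp (by fun_prop) hshift).sub (h.arc_p.contRho.mono hincl))
    ((ctan.comp (h.arc_m.contXi.comp (by fun_prop) hshift) fun t ht => h.arc_m.bound _ (hshift ht)).sub
      (ctan.comp (h.arc_p.contXi.mono hincl) fun t ht => h.arc_p.bound _ (hincl ht)))
    (fun t ht => by
      have h6 := h.arc_m.derivRho (c + t) ⟨by linarith [ht.1], by linarith [ht.2]⟩
      have h7 := h6.comp t ((hasDerivAt_id t).const_add c)
      rw [mul_one] at h7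
      exact h7.sub (h.arc_p.derivRho t ⟨ht.1, ht.2.trans_le ht1.2⟩))
    (by simp only [add_zero, hc0]; linarith)
    (fun t ht he => by
      have ht' : t ∈ Icc 0 t₁ := Ico_subset_Icc_self ht
      have h6 := h.abs_lt (hshift ht') (hincl ht') (sub_eq_zero.1 he)
      have hp : 0 < ξm (c + t) := p _ ⟨by linarith [ht.1], by linarith [ht.2]⟩
      rw [abs_of_pos (p₁ t ht), abs_of_pos hp] at h6
      exact sub_pos.2 (strictMonoOn_tan (h.arc_p.bound _ (hincl ht'))
        (h.arc_m.bound _ (hshift ht')) h6))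
    t₁ (right_mem_Icc.2 h1.le)
  have h6 := mono_m ⟨by linarith, by linarith⟩ (right_mem_Icc.2 hφ.2.le)
    (show c + t₁ < Φ by linarith)
  rw [h.m_right] at h6
  linarith

/-- The arc `q` has one maximum, as it spans less than `π`. Adding the `√2` bounds for both halves
of `m` and of `q`, all `ξ` cancel and `√2 * (4π / 3) ≤ 2π` minus two arctangent differences remains.
Each difference exceeds `π (1 - 2√2 / 3)`, exactly what a contradiction needs. -/
theorem false (h : PolarTheta ρp ξp ρm ξm ρq ξq Φ) : False := by
  have hpi := pi_pos
  have h₀ := h.left_pos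
  have h₁ : 0 < ρp Φ := by simpa using h.reflect.left_pos
  obtain ⟨φ, hφ, z, -, n, p⟩ := h.exists_bottom
  obtain ⟨t₁, t₀, t₂, h1, h2, h3, h4, h5, -⟩ := h.bottom_of_two_tops
  have a₁ := h.pi_div_six_lt_left
  have a₂ := h.left_lt
  have a₃ := h.right_lt_neg_pi_div_six
  have a₄ := h.neg_pi_div_three_lt_right
  have a₅ := h.angle_q_left
  have a₆ := h.angle_q_right
  have a₇ := h.angle_m_left
  have a₈ := h.angle_m_right
  have m₁ := (h.arc_m.sub hφ.1.le le_rfl).angle_from_bottom_le hφ.2 p z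
  have m₂ := ((h.arc_m.sub le_rfl hφ.2.le).reflect φ).angle_from_bottom_le (by linarith [hφ.1])
    (fun s hs => by
      simpa using n (φ - s) ⟨by linarith [hs.2], by linarith [hs.1]⟩)
    (by simpa using z)
  simp only [sub_self, sub_zero] at m₂
  rcases h.arc_q.single_top_or_bottom (by linarith [h.lt_two_pi]) (by linarith) (by linarith) with
    ⟨t, ht, zt, pt, nt⟩ | ⟨_, _, _, h6, -, -, h7, h8, -⟩
  · have q₁ := (h.arc_q.sub le_rfl ht.2.le).angle_to_top_le ht.1 pt zt
    have q₂ := ((h.arc_q.sub ht.1.le le_rfl).reflect (2 * π - Φ)).angle_to_top_le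
      (by linarith [ht.2])
      (fun s hs => by
        simpa using nt (2 * π - Φ - s) ⟨by linarith [hs.2], by linarith [hs.1]⟩)
      (by simpa using zt)
    simp only [sub_self, sub_zero] at q₂
    have e₁ := lt_arctan_slope_sub h₀.le a₁ a₂
    have e₂ := lt_arctan_slope_sub h₁.le (x := -ξp Φ) (by linarith) (by linarith)
    rw [h.q_left, a₅] at q₁
    rw [h.q_right, a₆, show -(-(π / 3) - ξp Φ) = π / 3 - -ξp Φ by ring] at q₂
    rw [h.m_right, show ξm Φ = 2 * π / 3 - -ξp Φ by linarith] at m₁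
    rw [h.m_left, show -ξm 0 = 2 * π / 3 - ξp 0 by linarith] at m₂
    linarith
  · linarith

end PolarTheta
end ThetaShrinker

/-! ### From arclength to the polar angle. -/

namespace ThetaShrinker

/-- A continuous positive density on `[0, L]` is the speed of a change of parameter. -/
theorem exists_reparametrization {κ : ℝ → ℝ} {L : ℝ} (hL : 0 < L) (hκ : ContinuousOn κ (Icc 0 L))
    (hpos : ∀ s ∈ Icc 0 L, 0 < κ s) :
    ∃ φ σ : ℝ → ℝ, φ 0 = 0 ∧ 0 < φ L ∧ StrictMono σ ∧ Continuous σ ∧ (∀ s, σ (φ s) = s) ∧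
      (∀ t, φ (σ t) = t) ∧ (∀ s ∈ Icc 0 L, HasDerivAt φ (κ s) s) ∧
      ∀ t, σ t ∈ Icc 0 L → HasDerivAt σ (κ (σ t))⁻¹ t := by
  -- Extension by the endpoint values makes `φ` a bijection of `ℝ` with two-sided derivatives even
  -- at `0` and `L`.
  set K : ℝ → ℝ := IccExtend hL.le ((Icc 0 L).domRestrict κ) with hK
  have cK : Continuous K := (continuousOn_iff_continuous_domRestrict.1 hκ).Icc_extend'
  have K_eq : ∀ s ∈ Icc 0 L, K s = κ s := fun s hs => IccExtend_of_mem hL.le _ hs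
  obtain ⟨x₀, hx₀, hmin⟩ := isCompact_Icc.exists_isMinOn (nonempty_Icc.2 hL.le) hκ
  have m0 := hpos x₀ hx₀
  have mK : ∀ s, κ x₀ ≤ K s := fun s => hmin (projIcc 0 L hL.le s).2
  set φ : ℝ → ℝ := fun s => ∫ x in (0 : ℝ)..s, K x with hφ
  have dφ : ∀ s, HasDerivAt φ (K s) s := fun s =>
    intervalIntegral.integral_hasDerivAt_right (cK.intervalIntegrable _ _)
      cK.stronglyMeasurable.stronglyMeasurableAtFilter cK.continuousAt
  have φ0 : φ 0 = 0 := intervalIntegral.integral_same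
  have mono : StrictMono φ := strictMono_of_deriv_pos fun s => by
    rw [(dφ s).deriv]
    exact m0.trans_le (mK s)
  have mono' : Monotone fun s => φ s - κ x₀ * s := by
    have hd : ∀ s, HasDerivAt (fun s => φ s - κ x₀ * s) (K s - κ x₀) s := fun s => by
      exact ((dφ s).sub ((hasDerivAt_id s).const_mul (κ x₀))).congr_deriv (by simp)
    refine monotone_of_deriv_nonneg (fun s => (hd s).differentiableAt) fun s => ?_
    rw [(hd s).deriv]
    linarith [mK s]
  have cφ : Continuous φ := continuous_iff_continuousAt.2 fun s => (dφ s).continuousAt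
  have surj : Function.Surjective φ := by
    refine cφ.surjective ?_ ?_
    · refine Filter.tendsto_atTop_mono' _ ?_ (Filter.tendsto_id.const_mul_atTop m0)
      filter_upwards [Filter.eventually_ge_atTop 0] with s hs
      have := mono' hs
      simp only [φ0, mul_zero, sub_zero] at this
      simp only [id]
      linarith
    · refine Filter.tendsto_atBot_mono' _ ?_ (Filter.tendsto_id.const_mul_atBot m0)
      filter_upwards [Filter.eventually_le_atBot 0] with s hs
      have := mono' hs
      simp only [φ0, mul_zero, sub_zero] at this
      simp only [id]
      linarith
  set e := StrictMono.orderIsoOfSurjective φ mono surj with he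
  have h1 : ∀ s, e.symm (φ s) = s := fun s => e.symm_apply_apply s
  have h2 : ∀ t, φ (e.symm t) = t := fun t => e.apply_symm_apply t
  refine ⟨φ, e.symm, φ0, by rw [← φ0]; exact mono hL, e.symm.strictMono, e.symm.continuous, h1, h2,
    fun s hs => by rw [← K_eq s hs]; exact dφ s, fun t ht => ?_⟩
  rw [← K_eq _ ht]
  exact (dφ _).of_local_left_inverse e.symm.continuous.continuousAt
    (m0.trans_le (mK _)).ne' (Filter.Eventually.of_forall h2)

open ComplexConjugate Complex

/-- A shrinking arc in the complex plane, with tangent `T` and curvature `Im (conj z * T)`. -/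
structure ComplexArc (z T : ℝ → ℂ) (L : ℝ) : Prop where
  pos : 0 < L
  deriv_point : ∀ s ∈ Icc 0 L, HasDerivWithinAt z (T s) (Icc 0 L) s
  deriv_tangent : ∀ s ∈ Icc 0 L,
    HasDerivWithinAt T (I * (conj (z s) * T s).im * T s) (Icc 0 L) s
  norm_tangent : ∀ s ∈ Icc 0 L, ‖T s‖ = 1
  injOn : InjOn z (Icc 0 L)

namespace ComplexArc

variable {z T : ℝ → ℂ} {L : ℝ}

theorem conjugate (h : ComplexArc z T L) :
    ComplexArc (fun s => conj (z s)) (fun s => conj (T s)) L where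
  pos := h.pos
  deriv_point s hs := (h.deriv_point s hs).star
  deriv_tangent s hs := by
    refine (h.deriv_tangent s hs).star.congr_deriv ?_
    simp only [star_def, map_mul, conj_I, conj_ofReal, Complex.conj_conj]
    rw [show z s * (starRingEnd ℂ) (T s) = starRingEnd ℂ (starRingEnd ℂ (z s) * T s) by simp, conj_im]
    push_cast
    ring
  norm_tangent s hs := by simpa using h.norm_tangent s hs
  injOn s hs t ht hst := h.injOn hs ht ((starRingEnd ℂ).injective hst)

theorem conj_mul_self (h : ComplexArc z T L) {s : ℝ} (hs : s ∈ Icc 0 L) :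
    starRingEnd ℂ (T s) * T s = 1 := by
  rw [Complex.conj_mul', h.norm_tangent s hs]
  norm_num

theorem hasDerivWithinAt_conj_mul (h : ComplexArc z T L) {s : ℝ} (hs : s ∈ Icc 0 L) :
    HasDerivWithinAt (fun s => starRingEnd ℂ (z s) * T s)
      (1 + I * (starRingEnd ℂ (z s) * T s).im * (starRingEnd ℂ (z s) * T s)) (Icc 0 L) s := by
  refine ((h.deriv_point s hs).star.mul (h.deriv_tangent s hs)).congr_deriv ?_
  simp only [star_def]
  rw [h.conj_mul_self hs]
  ring

theorem hasDerivWithinAt_re (h : ComplexArc z T L) {s : ℝ} (hs : s ∈ Icc 0 L) :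
    HasDerivWithinAt (fun s => (starRingEnd ℂ (z s) * T s).re)
      (1 - (starRingEnd ℂ (z s) * T s).im ^ 2) (Icc 0 L) s := by
  refine (reCLM.hasFDerivAt.comp_hasDerivWithinAt s (h.hasDerivWithinAt_conj_mul hs)).congr_deriv ?_
  simp
  ring

theorem hasDerivWithinAt_im (h : ComplexArc z T L) {s : ℝ} (hs : s ∈ Icc 0 L) :
    HasDerivWithinAt (fun s => (starRingEnd ℂ (z s) * T s).im)
      ((starRingEnd ℂ (z s) * T s).im * (starRingEnd ℂ (z s) * T s).re) (Icc 0 L) s := by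
  refine (imCLM.hasFDerivAt.comp_hasDerivWithinAt s (h.hasDerivWithinAt_conj_mul hs)).congr_deriv ?_
  simp

theorem hasDerivWithinAt_norm_sq (h : ComplexArc z T L) {s : ℝ} (hs : s ∈ Icc 0 L) :
    HasDerivWithinAt (fun s => ‖z s‖ ^ 2) (2 * (starRingEnd ℂ (z s) * T s).re) (Icc 0 L) s := by
  refine (h.deriv_point s hs).norm_sq.congr_deriv ?_
  rw [Complex.inner, mul_comm (T s)]

/-- From `k' = k u` and `(‖z‖²)' = 2u`, the product `k * exp (-‖z‖² / 2)` is constant; so `k` keeps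
its sign or vanishes identically. -/
theorem curvature_eq (h : ComplexArc z T L) {s : ℝ} (hs : s ∈ Icc 0 L) :
    (starRingEnd ℂ (z s) * T s).im
      = (starRingEnd ℂ (z 0) * T 0).im * Real.exp ((‖z s‖ ^ 2 - ‖z 0‖ ^ 2) / 2) := by
  have key : ∀ s ∈ Icc 0 L, HasDerivWithinAt
      (fun s => (starRingEnd ℂ (z s) * T s).im * Real.exp (-(‖z s‖ ^ 2 / 2))) 0 (Icc 0 L) s := by
    intro s hs
    refine ((h.hasDerivWithinAt_im hs).mul
      ((h.hasDerivWithinAt_norm_sq hs).div_const 2).neg.exp).congr_deriv ?_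
    simp only [Pi.neg_apply]
    ring
  have := constant_of_derivWithin_zero (fun s hs => (key s hs).differentiableWithinAt)
    (fun s hs => (key s (Ico_subset_Icc_self hs)).derivWithin
      (uniqueDiffOn_Icc h.pos s (Ico_subset_Icc_self hs))) s hs
  rw [show (‖z s‖ ^ 2 - ‖z 0‖ ^ 2) / 2 = -(‖z 0‖ ^ 2 / 2) + ‖z s‖ ^ 2 / 2 by ring, Real.exp_add,
    ← mul_assoc, ← this, mul_assoc, ← Real.exp_add, neg_add_cancel, Real.exp_zero, mul_one]

end ComplexArc

/-- A polar parametrization of an arc that runs counterclockwise around the origin. -/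
structure PolarForm (z T : ℝ → ℂ) (L : ℝ) (ρ ξ σ : ℝ → ℝ) (Φ : ℝ) : Prop where
  pos : 0 < Φ
  ne_zero : z 0 ≠ 0
  arc : PolarArc ρ ξ 0 Φ
  mapsTo : MapsTo σ (Icc 0 Φ) (Icc 0 L)
  strictMono : StrictMono σ
  left : σ 0 = 0
  right : σ Φ = L
  point : ∀ t ∈ Icc 0 Φ, z (σ t) = exp (ρ t + t * I) * (z 0 / ‖z 0‖)
  tangent : ∀ t ∈ Icc 0 Φ, T (σ t) = I * exp ((t - ξ t) * I) * (z 0 / ‖z 0‖)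

/-- Writing `conj z * T = u + k I`, the logarithmic derivative of `z` is `(u + k I) / ‖z‖²`. Hence
`k / ‖z‖² > 0` is the speed of the polar angle `φ`, and `ξ = arctan (u / k)`. -/
theorem ComplexArc.exists_polarForm {z T : ℝ → ℂ} {L : ℝ} (h : ComplexArc z T L)
    (hk : 0 < (conj (z 0) * T 0).im) : ∃ ρ ξ σ Φ, PolarForm z T L ρ ξ σ Φ := by
  obtain ⟨k, u, w, k0, dk, du, dr⟩ : ∃ k u : ℝ → ℝ,
      (∀ s, starRingEnd ℂ (z s) * T s = u s + k s * I) ∧ (∀ s ∈ Icc 0 L, 0 < k s) ∧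
      (∀ s ∈ Icc 0 L, HasDerivWithinAt k (k s * u s) (Icc 0 L) s) ∧
      (∀ s ∈ Icc 0 L, HasDerivWithinAt u (1 - k s ^ 2) (Icc 0 L) s) ∧
      (∀ s ∈ Icc 0 L, HasDerivWithinAt (fun s => ‖z s‖ ^ 2) (2 * u s) (Icc 0 L) s) :=
    ⟨fun s => (starRingEnd ℂ (z s) * T s).im, fun s => (starRingEnd ℂ (z s) * T s).re,
      fun s => (re_add_im _).symm, fun s hs => by
        change 0 < (starRingEnd ℂ (z s) * T s).im
        rw [h.curvature_eq hs]
        positivity,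
      fun s hs => h.hasDerivWithinAt_im hs, fun s hs => h.hasDerivWithinAt_re hs,
      fun s hs => h.hasDerivWithinAt_norm_sq hs⟩
  have z0 : ∀ s ∈ Icc 0 L, z s ≠ 0 := fun s hs e => by
    have h1 := congrArg Complex.im (w s)
    simp [e] at h1
    exact (k0 s hs).ne h1
  have r0 : ∀ s ∈ Icc 0 L, 0 < ‖z s‖ ^ 2 := fun s hs => by
    have := z0 s hs
    positivity
  have uk : ∀ s ∈ Icc 0 L, u s ^ 2 + k s ^ 2 = ‖z s‖ ^ 2 := fun s hs => by
    have h1 : ‖starRingEnd ℂ (z s) * T s‖ ^ 2 = ‖z s‖ ^ 2 := by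
      rw [norm_mul, h.norm_tangent s hs, mul_one, RCLike.norm_conj]
    rw [← h1, ← normSq_eq_norm_sq, w, normSq_add_mul_I]
  have ck : ContinuousOn k (Icc 0 L) := fun s hs => (dk s hs).continuousWithinAt
  have cu : ContinuousOn u (Icc 0 L) := fun s hs => (du s hs).continuousWithinAt
  have cr : ContinuousOn (fun s => ‖z s‖ ^ 2) (Icc 0 L) := fun s hs => (dr s hs).continuousWithinAt
  obtain ⟨φ, σ, φ0, hΦ, mono, cσ, σφ, φσ, dφ, dσ⟩ := exists_reparametrization
    (κ := fun s => k s / ‖z s‖ ^ 2) h.pos (ck.div cr fun s hs => (r0 s hs).ne') (fun s hs => div_pos (k0 s hs) (r0 s hs))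
  have σ0 : σ 0 = 0 := by simpa [φ0] using σφ 0
  have σΦ : σ (φ L) = L := σφ L
  have maps : MapsTo σ (Icc 0 (φ L)) (Icc 0 L) := fun t ht =>
    ⟨by rw [← σ0]; exact mono.monotone ht.1, by rw [← σΦ]; exact mono.monotone ht.2⟩
  have maps' : ∀ t ∈ Ioo 0 (φ L), σ t ∈ Ioo 0 L := fun t ht =>
    ⟨by rw [← σ0]; exact mono ht.1, by rw [← σΦ]; exact mono ht.2⟩
  have expρ : ∀ s ∈ Icc 0 L, Real.exp (Real.log (‖z s‖ ^ 2) / 2) = ‖z s‖ := fun s hs => by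
    rw [Real.log_pow]
    push_cast
    rw [mul_div_cancel_left₀ _ two_ne_zero, Real.exp_log (norm_pos_iff.2 (z0 s hs))]
  have hpoint : ∀ s ∈ Icc 0 L, z s = exp ((Real.log (‖z s‖ ^ 2) / 2 : ℝ) + φ s * I)
      * (z 0 / ‖z 0‖) := by
    have key : ∀ s ∈ Icc 0 L, HasDerivWithinAt
        (fun s => z s * exp (-((Real.log (‖z s‖ ^ 2) / 2 : ℝ) + φ s * I))) 0 (Icc 0 L) s := by
      intro s hs
      have d1 := (((dr s hs).log (r0 s hs).ne').div_const 2).ofReal_comp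
      have d2 := ((dφ s hs).hasDerivWithinAt (s := Icc 0 L)).ofReal_comp.mul_const I
      refine ((h.deriv_point s hs).mul (d1.add d2).neg.cexp).congr_deriv ?_
      simp only [Pi.neg_apply, Pi.add_apply]
      have hz := z0 s hs
      have e1 : z s * ((u s : ℂ) + k s * I) = T s * (‖z s‖ ^ 2 : ℝ) := by
        rw [← w, ← mul_assoc, mul_conj, normSq_eq_norm_sq]
        ring
      have hr : ((‖z s‖ ^ 2 : ℝ) : ℂ) ≠ 0 := ofReal_ne_zero.2 (r0 s hs).ne'
      have e2 : T s = z s * ((u s : ℂ) + k s * I) / (‖z s‖ ^ 2 : ℝ) := by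
        rw [eq_div_iff hr, e1]
      rw [e2]
      push_cast at hr ⊢
      field_simp
      ring
    intro s hs
    have := constant_of_derivWithin_zero (fun s hs => (key s hs).differentiableWithinAt)
      (fun s hs => (key s (Ico_subset_Icc_self hs)).derivWithin
      (uniqueDiffOn_Icc h.pos s (Ico_subset_Icc_self hs))) s hs
    simp only [φ0, ofReal_zero, zero_mul, add_zero] at this
    have hz : (‖z 0‖ : ℂ) = exp ((Real.log (‖z 0‖ ^ 2) / 2 : ℝ) : ℂ) := by
      rw [← ofReal_exp, expρ 0 (left_mem_Icc.2 h.pos.le)]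
    rw [hz, div_eq_mul_inv (z 0), ← Complex.exp_neg, ← this, mul_comm, mul_assoc, ← Complex.exp_add,
      neg_add_cancel, Complex.exp_zero, mul_one]
  have hcos : ∀ s ∈ Icc 0 L, ‖z s‖ * Real.cos (Real.arctan (u s / k s)) = k s := fun s hs => by
    have hk := k0 s hs
    have h1 : 1 + (u s / k s) ^ 2 = (‖z s‖ / k s) ^ 2 := by
      rw [div_pow ‖z s‖, ← uk s hs]
      field_simp
      ring
    rw [Real.cos_arctan, h1, Real.sqrt_sq (by positivity)]
    have := norm_ne_zero_iff.2 (z0 s hs)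
    field_simp
  have hsin : ∀ s ∈ Icc 0 L, ‖z s‖ * Real.sin (Real.arctan (u s / k s)) = u s := fun s hs => by
    have hk := k0 s hs
    have h1 : Real.sin (Real.arctan (u s / k s)) = u s / k s * Real.cos (Real.arctan (u s / k s)) := by
      rw [Real.sin_arctan, Real.cos_arctan]
      ring
    rw [h1, mul_left_comm, hcos s hs]
    field_simp
  refine ⟨fun t => Real.log (‖z (σ t)‖ ^ 2) / 2, fun t => Real.arctan (u (σ t) / k (σ t)), σ, φ L,
    hΦ, z0 0 (left_mem_Icc.2 h.pos.le), ⟨?_, ?_, ?_, ?_, fun t _ => Real.arctan_mem_Ioo _⟩, maps, mono, σ0, σΦ, ?_, ?_⟩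
  · exact ((cr.comp cσ.continuousOn maps).log fun t ht => (r0 _ (maps ht)).ne').div_const 2
  · exact Real.continuous_arctan.comp_continuousOn ((cu.comp cσ.continuousOn maps).div
      (ck.comp cσ.continuousOn maps) fun t ht => (k0 _ (maps ht)).ne')
  · intro t ht
    have hs := maps (Ioo_subset_Icc_self ht)
    have hs' := Icc_mem_nhds (maps' t ht).1 (maps' t ht).2
    have hk := k0 _ hs
    have hr := r0 _ hs
    refine ((((dr _ hs).hasDerivAt hs').comp t (dσ t hs)).log hr.ne' |>.div_const 2).congr_deriv ?_
    rw [Real.tan_arctan]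
    have hz := norm_ne_zero_iff.2 (z0 _ hs)
    simp only [Function.comp_apply]
    field_simp
  · intro t ht
    have hs := maps (Ioo_subset_Icc_self ht)
    have hs' := Icc_mem_nhds (maps' t ht).1 (maps' t ht).2
    have hk := k0 _ hs
    have hr := r0 _ hs
    have hz := norm_ne_zero_iff.2 (z0 _ hs)
    have d1 := ((du _ hs).div (dk _ hs) hk.ne').hasDerivAt hs'
    refine (d1.comp t (dσ t hs)).arctan.congr_deriv ?_
    have h1 : Real.exp (2 * (Real.log (‖z (σ t)‖ ^ 2) / 2)) = ‖z (σ t)‖ ^ 2 := by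
      rw [mul_div_cancel₀ _ two_ne_zero, Real.exp_log hr]
    rw [h1]
    have h2 := uk _ hs
    have h3 : 1 + (u (σ t) / k (σ t)) ^ 2 = ‖z (σ t)‖ ^ 2 / k (σ t) ^ 2 := by
      rw [← h2]
      field_simp
      ring
    simp only [Function.comp_apply, Pi.div_apply]
    rw [h3, ← h2]
    have h4 : u (σ t) ^ 2 + k (σ t) ^ 2 ≠ 0 := by positivity
    field_simp
    ring
  · intro t ht
    have := hpoint _ (maps ht)
    rw [φσ] at this
    exact this
  · intro t ht
    have hs := maps ht
    have h1 := hpoint _ hs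
    rw [φσ] at h1
    set s := σ t with hst
    set ξ := Real.arctan (u s / k s) with hξ
    have hz := z0 _ hs
    have hr : (‖z s‖ : ℂ) ≠ 0 := ofReal_ne_zero.2 (norm_ne_zero_iff.2 hz)
    have h2 : starRingEnd ℂ (z s) * T s = ‖z s‖ * (I * exp (-(ξ * I))) := by
      rw [← neg_mul, Complex.exp_mul_I, Complex.cos_neg, Complex.sin_neg, ← ofReal_cos, ← ofReal_sin,
        w s]
      have h3 := congrArg ofReal (hcos s hs)
      have h4 := congrArg ofReal (hsin s hs)
      rw [← hξ, ofReal_mul] at h3 h4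
      linear_combination (‖z s‖ : ℂ) * (Real.sin ξ : ℂ) * I_sq - h4 - I * h3
    have h3 : z s = ‖z s‖ * exp (t * I) * (z 0 / ‖z 0‖) := by
      rw [Complex.exp_add, ← ofReal_exp, expρ s hs] at h1
      exact h1
    have h4 : z s * (starRingEnd ℂ (z s) * T s) = ‖z s‖ ^ 2 * T s := by
      rw [← mul_assoc, mul_conj, normSq_eq_norm_sq]
      push_cast
      ring
    have h5 : (‖z s‖ : ℂ) ^ 2 * T s = ‖z s‖ ^ 2 * (I * exp ((t - ξ) * I) * (z 0 / ‖z 0‖)) := by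
      rw [← h4, h2, sub_mul, sub_eq_add_neg, Complex.exp_add]
      nth_rewrite 1 [h3]
      ring
    exact mul_left_cancel₀ (pow_ne_zero 2 hr) h5

end ThetaShrinker

/-! ### Winding around the origin. -/

namespace ThetaShrinker
open Real

/-- The chord theorem: a continuous function with equal values at the endpoints of an interval of
length `N * c` has a chord of length `c`. -/
theorem exists_chord {f : ℝ → ℝ} {a c : ℝ} {N : ℕ} (hN : 1 ≤ N) (hc : 0 < c)
    (hf : ContinuousOn f (Icc a (a + N * c))) (hend : f (a + N * c) = f a) :
    ∃ t ∈ Icc a (a + N * c - c), f (t + c) = f t := by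
  have no_sign : ∀ g : ℝ → ℝ, g (a + N * c) = g a →
      ¬ ∀ t ∈ Icc a (a + N * c - c), g t < g (t + c) := by
    intro g hg hlt
    have key : ∀ j : ℕ, j < N → g a < g (a + (j + 1 : ℕ) * c) := by
      intro j
      induction j with
      | zero =>
        intro hj
        have h1 : (1 : ℝ) ≤ N := by exact_mod_cast hj
        simpa using hlt a ⟨le_rfl, by nlinarith⟩
      | succ j ih =>
        intro hj
        have h1 : ((j : ℝ) + 1 + 1) ≤ N := by exact_mod_cast hj
        have h2 := hlt (a + (j + 1 : ℕ) * c) ⟨by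
          have : 0 ≤ ((j + 1 : ℕ) : ℝ) * c := by positivity
          linarith, by push_cast; nlinarith⟩
        refine (ih (by omega)).trans (h2.trans_eq ?_)
        congr 1
        push_cast
        ring
    obtain ⟨j, rfl⟩ : ∃ j, N = j + 1 := ⟨N - 1, by omega⟩
    exact (key j (by omega)).ne' hg
  have h1 : (1 : ℝ) ≤ N := by exact_mod_cast hN
  have cD : ContinuousOn (fun t => f (t + c) - f t) (Icc a (a + N * c - c)) :=
    (hf.comp (by fun_prop) fun t ht => ⟨by linarith [ht.1], by linarith [ht.2]⟩).sub
      (hf.mono (Icc_subset_Icc le_rfl (by linarith)))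
  by_contra! hne
  obtain ⟨t, ht, hpos⟩ : ∃ t ∈ Icc a (a + N * c - c), f t < f (t + c) := by
    by_contra! hcon
    exact no_sign (fun t => -f t) (by simp [hend]) fun t ht =>
      neg_lt_neg (lt_of_le_of_ne (hcon t ht) (hne t ht))
  obtain ⟨s, hs, hneg⟩ : ∃ t ∈ Icc a (a + N * c - c), f (t + c) < f t := by
    by_contra! hcon
    exact no_sign f hend fun t ht => lt_of_le_of_ne (hcon t ht) (hne t ht).symm
  obtain ⟨x, hx, hx0⟩ := isPreconnected_Icc.intermediate_value hs ht cD
    (⟨by linarith, by linarith⟩ : (0 : ℝ) ∈ Icc (f (s + c) - f s) (f (t + c) - f t))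
  exact hne x hx (sub_eq_zero.1 hx0)

/-- If the inner arc started strictly steeper, the difference of the two `ρ` would become
nonnegative and stay so. -/
theorem PolarArc.le_of_lt {ρ ξ ρ' ξ' : ℝ → ℝ} {a b : ℝ} (h : PolarArc ρ ξ a b)
    (h' : PolarArc ρ' ξ' a b) (hab : a < b) (hlt : ∀ t ∈ Ioo a b, ρ t < ρ' t) (ha : ρ a = ρ' a) :
    ξ a ≤ ξ' a := by
  by_contra! hcon
  have ctan : ContinuousOn tan (Ioo (-(π / 2)) (π / 2)) := continuousOn_tan_Ioo
  have hmem : a ∈ Icc a b := left_mem_Icc.2 hab.le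
  have hm : (a + b) / 2 ∈ Ioo a b := ⟨by linarith, by linarith⟩
  have := nonneg_of_deriv_pos_at_zeros (h.contRho.sub h'.contRho)
    ((ctan.comp h.contXi h.bound).sub (ctan.comp h'.contXi h'.bound))
    (fun t ht => (h.derivRho t ht).sub (h'.derivRho t ht)) (sub_nonneg.2 ha.ge)
    (fun t ht h0 => by
      rcases ht.1.eq_or_lt with rfl | h1
      · exact sub_pos.2 (strictMonoOn_tan (h'.bound _ hmem) (h.bound _ hmem) hcon)
      · exact absurd (sub_eq_zero.1 h0) (hlt t ⟨h1, ht.2⟩).ne)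
    _ (Ioo_subset_Icc_self hm)
  exact (hlt _ hm).not_ge (sub_nonneg.1 this)

theorem PolarArc.le_of_lt' {ρ ξ ρ' ξ' : ℝ → ℝ} {a b : ℝ} (h : PolarArc ρ ξ a b)
    (h' : PolarArc ρ' ξ' a b) (hab : a < b) (hlt : ∀ t ∈ Ioo a b, ρ t < ρ' t) (hb : ρ b = ρ' b) :
    ξ' b ≤ ξ b := by
  have := (h.reflect (a + b)).le_of_lt (h'.reflect (a + b)) (by linarith)
    (fun t ht => hlt _ ⟨by linarith [ht.2], by linarith [ht.1]⟩) (by simpa using hb)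
  simpa using this

theorem abs_eq_of_cos_eq {x y : ℝ} (hx : |x| ≤ π) (hy : 0 ≤ y) (hy' : y ≤ π) (h : cos x = cos y) :
    |x| = y :=
  injOn_cos ⟨abs_nonneg x, hx⟩ ⟨hy, hy'⟩ (by rw [cos_abs, h])

theorem cos_two_pi_div_three : cos (2 * π / 3) = -1 / 2 := by
  rw [show 2 * π / 3 = π - π / 3 by ring, cos_pi_sub, cos_pi_div_three]
  norm_num

open ComplexConjugate Complex

namespace PolarForm

variable {z T : ℝ → ℂ} {L Φ : ℝ} {ρ ξ σ : ℝ → ℝ}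

theorem norm_div_norm (p : PolarForm z T L ρ ξ σ Φ) : ‖z 0 / (‖z 0‖ : ℂ)‖ = 1 := by
  have := norm_ne_zero_iff.2 p.ne_zero
  rw [norm_div, norm_real, norm_norm, div_self this]

theorem exp_rho (p : PolarForm z T L ρ ξ σ Φ) {t : ℝ} (ht : t ∈ Icc 0 Φ) :
    Real.exp (ρ t) = ‖z (σ t)‖ := by
  rw [p.point t ht, norm_mul, p.norm_div_norm, Complex.norm_exp]
  simp

theorem eq_of_eq (p : PolarForm z T L ρ ξ σ Φ) (h : ComplexArc z T L) {s t : ℝ} (hs : s ∈ Icc 0 Φ)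
    (ht : t ∈ Icc 0 Φ) (hst : z (σ s) = z (σ t)) : s = t :=
  p.strictMono.injective (h.injOn (p.mapsTo hs) (p.mapsTo ht) hst)

theorem point_of_conj (p : PolarForm (fun s => conj (z s)) (fun s => conj (T s)) L ρ ξ σ Φ) {t : ℝ}
    (ht : t ∈ Icc 0 Φ) : z (σ t) = exp (ρ t + (-t : ℝ) * I) * (z 0 / ‖z 0‖) := by
  have h1 := congrArg (starRingEnd ℂ) (p.point t ht)
  simp only [Complex.conj_conj, map_mul, map_div₀, conj_ofReal, RCLike.norm_conj, ← exp_conj, map_add,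
    conj_I] at h1
  rw [h1]
  push_cast
  ring_nf

theorem tangent_of_conj (p : PolarForm (fun s => conj (z s)) (fun s => conj (T s)) L ρ ξ σ Φ) {t : ℝ}
    (ht : t ∈ Icc 0 Φ) : T (σ t) = I * exp ((π - t + ξ t : ℝ) * I) * (z 0 / ‖z 0‖) := by
  have h1 := congrArg (starRingEnd ℂ) (p.tangent t ht)
  simp only [Complex.conj_conj, map_mul, map_div₀, conj_ofReal, RCLike.norm_conj, ← exp_conj, map_sub,
    conj_I] at h1
  rw [h1, show ((π - t + ξ t : ℝ) : ℂ) * I = π * I + (t - ξ t) * -I by push_cast; ring, Complex.exp_add,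
    exp_pi_mul_I]
  ring

end PolarForm

theorem re_tangent_mul_conj {e : ℂ} (he : ‖e‖ = 1) (x y : ℝ) :
    (I * exp (x * I) * e * conj (I * exp (y * I) * e)).re = Real.cos (x - y) := by
  have h1 : e * conj e = 1 := by
    rw [mul_conj, normSq_eq_norm_sq, he]
    norm_num
  have h2 : I * exp (x * I) * e * conj (I * exp (y * I) * e) = exp ((x - y : ℝ) * I) := by
    simp only [map_mul, conj_I, ← exp_conj, conj_ofReal]
    rw [show ((x - y : ℝ) : ℂ) * I = x * I + y * -I by push_cast; ring, Complex.exp_add]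
    linear_combination (-I * I * exp (x * I) * exp (y * -I)) * h1
      - exp (x * I) * exp (y * -I) * I_sq
  rw [h2, exp_ofReal_mul_I_re]

/-- Two arcs that run around the origin in opposite directions and meet only at their endpoints
form a closed curve that winds around the origin exactly once. -/
theorem add_eq_two_pi {z T z' T' : ℝ → ℂ} {L L' Φ Φ' : ℝ} {ρ ξ σ ρ' ξ' σ' : ℝ → ℝ}
    (h : ComplexArc z T L) (h' : ComplexArc z' T' L') (p : PolarForm z T L ρ ξ σ Φ)
    (p' : PolarForm (fun s => conj (z' s)) (fun s => conj (T' s)) L' ρ' ξ' σ' Φ')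
    (left : z 0 = z' 0) (right : z L = z' L')
    (inter : ∀ s ∈ Icc 0 L, ∀ t ∈ Icc 0 L', z s = z' t → z s = z 0 ∨ z s = z L) :
    Φ + Φ' = 2 * π := by
  set e := z 0 / (‖z 0‖ : ℂ) with he
  have he0 : e ≠ 0 := norm_ne_zero_iff.1 (by rw [p.norm_div_norm]; exact one_ne_zero)
  have l₁ := left_mem_Icc.2 p.pos.le
  have l₂ := left_mem_Icc.2 p'.pos.le
  have r₁ := right_mem_Icc.2 p.pos.le
  have r₂ := right_mem_Icc.2 p'.pos.le
  have hρ0 : ρ 0 = ρ' 0 := by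
    apply Real.exp_injective
    rw [p.exp_rho l₁, p'.exp_rho l₂, p.left, p'.left, RCLike.norm_conj, left]
  have pt := fun t (ht : t ∈ Icc 0 Φ) => p.point t ht
  have pt' : ∀ t ∈ Icc 0 Φ', z' (σ' t) = exp (ρ' t + (-t : ℝ) * I) * e := fun t ht => by
    rw [p'.point_of_conj ht, he, left]
  have hend : exp (ρ Φ + Φ * I) = exp (ρ' Φ' + (-Φ' : ℝ) * I) := by
    refine mul_right_cancel₀ he0 ?_
    rw [← pt _ r₁, ← pt' _ r₂, p.right, p'.right, right]
  obtain ⟨n, hn⟩ := exp_eq_exp_iff_exists_int.1 hend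
  have hre : ρ Φ = ρ' Φ' := by simpa using congrArg Complex.re hn
  have him : Φ + Φ' = n * (2 * π) := by
    have := congrArg Complex.im hn
    simp at this
    linarith
  have hpi := Real.pi_pos
  have hn1 : 0 < n := by
    have h1 : 0 < (n : ℝ) * (2 * π) := him ▸ add_pos p.pos p'.pos
    exact_mod_cast pos_of_mul_pos_left h1 (by positivity)
  obtain ⟨N, rfl⟩ := Int.eq_ofNat_of_zero_le hn1.le
  have hN : 1 ≤ N := by exact_mod_cast hn1
  simp only [Int.cast_natCast] at him
  -- The logarithm of the distance along the closed curve, over a total polar angle `2πN`: the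
  -- clockwise arc reversed on `[-Φ', 0]`, then the counterclockwise one on `[0, Φ]`.
  set G : ℝ → ℝ := fun t => ρ (max t 0) + ρ' (max (-t) 0) - ρ 0 with hG
  have G_nonneg : ∀ t, 0 ≤ t → G t = ρ t := fun t ht => by
    simp only [hG, max_eq_left ht, max_eq_right (neg_nonpos.2 ht), hρ0]
    ring
  have G_nonpos : ∀ t, t ≤ 0 → G t = ρ' (-t) := fun t ht => by
    simp only [hG, max_eq_right ht, max_eq_left (neg_nonneg.2 ht)]
    ring
  have hb : -Φ' + N * (2 * π) = Φ := by linarith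
  -- A chord of length `2π` is a coincidence of two points of the curve. Embeddedness allows it only
  -- for the two ends of the parameter interval, that is for `Φ + Φ' = 2π`.
  obtain ⟨t, ht, hchord⟩ := exists_chord (f := G) (a := -Φ') (c := 2 * π) hN (by positivity) (by
    rw [hb]
    refine ((p.arc.contRho.comp (by fun_prop) fun t ht => ?_).add
      (p'.arc.contRho.comp (by fun_prop) fun t ht => ?_)).sub continuousOn_const
    · exact ⟨le_max_right _ _, max_le ht.2 p.pos.le⟩
    · exact ⟨le_max_right _ _, max_le (by linarith [ht.1]) p'.pos.le⟩) (by
    rw [hb, G_nonneg _ p.pos.le, G_nonpos _ (by linarith [p'.pos]), neg_neg, hre])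
  rw [hb] at ht
  have hP : exp (G (t + 2 * π) + (t + 2 * π : ℝ) * I) * e = exp (G t + t * I) * e := by
    rw [hchord]
    congr 1
    rw [show (G t : ℂ) + (t + 2 * π : ℝ) * I = G t + t * I + 2 * π * I by push_cast; ring,
      exp_periodic]
  rcases le_or_gt 0 t with h0 | h0
  · rw [G_nonneg _ h0, G_nonneg _ (by linarith), ← pt _ ⟨h0, by linarith [ht.2]⟩,
      ← pt _ ⟨by linarith, by linarith [ht.2]⟩] at hP
    have := p.eq_of_eq h ⟨by linarith, by linarith [ht.2]⟩ ⟨h0, by linarith [ht.2]⟩ hP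
    linarith
  rcases le_or_gt (t + 2 * π) 0 with h1 | h1
  · have m₁ : -t ∈ Icc 0 Φ' := ⟨by linarith, by linarith [ht.1]⟩
    have m₂ : -(t + 2 * π) ∈ Icc 0 Φ' := ⟨by linarith, by linarith [ht.1]⟩
    have e₁ := pt' _ m₁
    have e₂ := pt' _ m₂
    rw [neg_neg] at e₁ e₂
    rw [G_nonpos _ h0.le, G_nonpos _ h1, ← e₁, ← e₂] at hP
    have := p'.eq_of_eq h'.conjugate m₂ m₁ (congrArg (starRingEnd ℂ) hP)
    linarith
  · have m₁ : -t ∈ Icc 0 Φ' := ⟨by linarith, by linarith [ht.1]⟩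
    have m₂ : t + 2 * π ∈ Icc 0 Φ := ⟨h1.le, by linarith [ht.2]⟩
    have e₁ := pt' _ m₁
    rw [neg_neg] at e₁
    rw [G_nonpos _ h0.le, G_nonneg _ h1.le, ← e₁, ← pt _ m₂] at hP
    rcases inter _ (p.mapsTo m₂) _ (p'.mapsTo m₁) hP with h2 | h2
    · have := p.eq_of_eq h m₂ l₁ (by rw [h2, p.left])
      linarith
    · have h3 := p.eq_of_eq h m₂ r₁ (by rw [h2, p.right])
      have h4 := p'.eq_of_eq h'.conjugate m₁ r₂ (by rw [← hP, h2, p'.right, right])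
      linarith

end ThetaShrinker

/-! ### Sign patterns of the curvatures at the triple junction. -/

namespace ThetaShrinker
open Real ComplexConjugate Complex

/-- A regular theta shrinker in the complex plane, with tangents `T`. -/
structure ComplexTheta (z T : Fin 3 → ℝ → ℂ) (L : Fin 3 → ℝ) (A B : ℂ) : Prop where
  arc : ∀ i, ComplexArc (z i) (T i) (L i)
  left : ∀ i, z i 0 = A
  right : ∀ i, z i (L i) = B
  inter : ∀ i j, i ≠ j → ∀ s ∈ Icc 0 (L i), ∀ t ∈ Icc 0 (L j), z i s = z j t → z i s = A ∨ z i s = B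
  angle_left : ∀ i j, i ≠ j → (T i 0 * conj (T j 0)).re = -1 / 2
  angle_right : ∀ i j, i ≠ j → (T i (L i) * conj (T j (L j))).re = -1 / 2

namespace ComplexTheta

variable {z T : Fin 3 → ℝ → ℂ} {L : Fin 3 → ℝ} {A B : ℂ}

theorem conjugate (h : ComplexTheta z T L A B) :
    ComplexTheta (fun i s => conj (z i s)) (fun i s => conj (T i s)) L (conj A) (conj B) where
  arc i := (h.arc i).conjugate
  left i := by rw [h.left]
  right i := by rw [h.right]
  inter i j hij s hs t ht hst :=
    (h.inter i j hij s hs t ht ((starRingEnd ℂ).injective hst)).imp (congrArg _) (congrArg _)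
  angle_left i j hij := by rw [← map_mul, conj_re, h.angle_left i j hij]
  angle_right i j hij := by rw [← map_mul, conj_re, h.angle_right i j hij]

theorem add_eq_two_pi (h : ComplexTheta z T L A B) {i j : Fin 3} (hij : i ≠ j)
    {ρ ξ σ ρ' ξ' σ' : ℝ → ℝ} {Φ Φ' : ℝ} (p : PolarForm (z i) (T i) (L i) ρ ξ σ Φ)
    (q : PolarForm (fun s => conj (z j s)) (fun s => conj (T j s)) (L j) ρ' ξ' σ' Φ') :
    Φ + Φ' = 2 * π :=
  ThetaShrinker.add_eq_two_pi (h.arc i) (h.arc j) p q (by rw [h.left, h.left])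
    (by rw [h.right, h.right]) fun s hs t ht hst => by
      rw [h.left, h.right]
      exact h.inter i j hij s hs t ht hst

theorem ne_of_mem_Ioo (h : ComplexTheta z T L A B) {i j : Fin 3} (hij : i ≠ j)
    {ρ ξ σ ρ' ξ' σ' : ℝ → ℝ} {Φ : ℝ} (p : PolarForm (z i) (T i) (L i) ρ ξ σ Φ)
    (p' : PolarForm (z j) (T j) (L j) ρ' ξ' σ' Φ) {t : ℝ} (ht : t ∈ Ioo 0 Φ) : ρ t ≠ ρ' t := by
  intro heq
  have ht' := Ioo_subset_Icc_self ht
  have h1 : z i (σ t) = z j (σ' t) := by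
    rw [p.point t ht', p'.point t ht', heq, h.left, h.left]
  rcases h.inter i j hij _ (p.mapsTo ht') _ (p'.mapsTo ht') h1 with h2 | h2
  · exact ht.1.ne' (p.eq_of_eq (h.arc i) ht' (left_mem_Icc.2 p.pos.le) (by rw [h2, p.left, h.left]))
  · exact ht.2.ne (p.eq_of_eq (h.arc i) ht' (right_mem_Icc.2 p.pos.le) (by rw [h2, p.right, h.right]))

/-- The 120 degree conditions determine only cosines. The order of the two counterclockwise arcs
fixes the sign of `ξ - ξ'` at each end; then `ξ + ξq` and `ξ' + ξq`, both of modulus `π / 3`, differ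
by `2π / 3`, which fixes their signs as well. -/
theorem false_of_inside (h : ComplexTheta z T L A B) {i j l : Fin 3} (hij : i ≠ j) (hil : i ≠ l)
    (hjl : j ≠ l) {ρ ξ σ ρ' ξ' σ' ρq ξq σq : ℝ → ℝ} {Φ : ℝ} (p : PolarForm (z i) (T i) (L i) ρ ξ σ Φ)
    (m : PolarForm (z j) (T j) (L j) ρ' ξ' σ' Φ)
    (q : PolarForm (fun s => conj (z l s)) (fun s => conj (T l s)) (L l) ρq ξq σq (2 * π - Φ))
    (inside : ∀ t ∈ Ioo 0 Φ, ρ' t < ρ t) : False := by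
  have hpi := Real.pi_pos
  have l₁ := left_mem_Icc.2 p.pos.le
  have l₂ := left_mem_Icc.2 q.pos.le
  have r₁ := right_mem_Icc.2 p.pos.le
  have r₂ := right_mem_Icc.2 q.pos.le
  have left_m : ρ' 0 = ρ 0 := by
    apply Real.exp_injective
    rw [p.exp_rho l₁, m.exp_rho l₁, p.left, m.left, h.left, h.left]
  have left_q : ρq 0 = ρ 0 := by
    apply Real.exp_injective
    rw [p.exp_rho l₁, q.exp_rho l₂, p.left, q.left, RCLike.norm_conj, h.left, h.left]
  have right_m : ρ' Φ = ρ Φ := by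
    apply Real.exp_injective
    rw [p.exp_rho r₁, m.exp_rho r₁, p.right, m.right, h.right, h.right]
  have right_q : ρq (2 * π - Φ) = ρ Φ := by
    apply Real.exp_injective
    rw [p.exp_rho r₁, q.exp_rho r₂, p.right, q.right, RCLike.norm_conj, h.right, h.right]
  have ord_left := m.arc.le_of_lt p.arc p.pos inside left_m
  have ord_right := m.arc.le_of_lt' p.arc p.pos inside right_m
  have pb := p.arc.bound _ l₁
  have mb := m.arc.bound _ l₁
  have qb := q.arc.bound _ l₂
  have pb' := p.arc.bound _ r₁
  have mb' := m.arc.bound _ r₁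
  have qb' := q.arc.bound _ r₂
  have he := p.norm_div_norm
  rw [h.left] at he
  have tp : ∀ t ∈ Icc 0 Φ, T i (σ t) = I * exp ((t - ξ t : ℝ) * I) * (A / ‖A‖) := fun t ht => by
    rw [p.tangent t ht, h.left, ofReal_sub]
  have tm : ∀ t ∈ Icc 0 Φ, T j (σ' t) = I * exp ((t - ξ' t : ℝ) * I) * (A / ‖A‖) := fun t ht => by
    rw [m.tangent t ht, h.left, ofReal_sub]
  have tq : ∀ t ∈ Icc 0 (2 * π - Φ), T l (σq t) = I * exp ((π - t + ξq t : ℝ) * I) * (A / ‖A‖) :=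
    fun t ht => by rw [q.tangent_of_conj ht, h.left]
  have flip : ∀ x y : ℝ, Real.cos (x - y) = -1 / 2 → Real.cos (y - x + π) = Real.cos (π / 3) := by
    intro x y hxy
    rw [Real.cos_add_pi, ← Real.cos_neg, neg_sub, hxy, Real.cos_pi_div_three]
    norm_num
  have a₁ := h.angle_left i j hij
  have a₂ := h.angle_left i l hil
  have a₃ := h.angle_left j l hjl
  have b₁ := h.angle_right i j hij
  have b₂ := h.angle_right i l hil
  have b₃ := h.angle_right j l hjl
  rw [← p.right, ← m.right, tp _ r₁, tm _ r₁, re_tangent_mul_conj he, ← cos_two_pi_div_three] at b₁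
  rw [← p.right, ← q.right, tp _ r₁, tq _ r₂, re_tangent_mul_conj he] at b₂
  rw [← m.right, ← q.right, tm _ r₁, tq _ r₂, re_tangent_mul_conj he] at b₃
  have tp₀ := tp 0 l₁
  have tm₀ := tm 0 l₁
  have tq₀ := tq 0 l₂
  rw [p.left] at tp₀
  rw [m.left] at tm₀
  rw [q.left] at tq₀
  rw [tp₀, tm₀, re_tangent_mul_conj he, ← cos_two_pi_div_three] at a₁
  rw [tp₀, tq₀, re_tangent_mul_conj he] at a₂
  rw [tm₀, tq₀, re_tangent_mul_conj he] at a₃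
  have d : |0 - ξ 0 - (0 - ξ' 0)| = 2 * π / 3 :=
    abs_eq_of_cos_eq (abs_le.2 ⟨by linarith [pb.2, mb.1], by linarith [pb.1, mb.2]⟩)
      (by positivity) (by linarith) a₁
  have d' : |Φ - ξ Φ - (Φ - ξ' Φ)| = 2 * π / 3 :=
    abs_eq_of_cos_eq (abs_le.2 ⟨by linarith [pb'.2, mb'.1], by linarith [pb'.1, mb'.2]⟩)
      (by positivity) (by linarith) b₁
  rw [abs_of_nonpos (by linarith)] at d
  rw [abs_of_nonneg (by linarith)] at d'
  have c₂ := abs_eq_of_cos_eq (x := ξ 0 + ξq 0) (abs_le.2 ⟨by linarith [pb.1, qb.1],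
    by linarith [pb.2, qb.2]⟩) (by positivity) (by linarith) (by
      rw [← flip _ _ a₂, ← Real.cos_sub_two_pi (_ + π)]
      congr 1
      ring : _ = Real.cos (π / 3))
  have c₃ := abs_eq_of_cos_eq (x := ξ' 0 + ξq 0) (abs_le.2 ⟨by linarith [mb.1, qb.1],
    by linarith [mb.2, qb.2]⟩) (by positivity) (by linarith) (by
      rw [← flip _ _ a₃, ← Real.cos_sub_two_pi (_ + π)]
      congr 1
      ring : _ = Real.cos (π / 3))
  have e₂ := abs_eq_of_cos_eq (x := ξ Φ + ξq (2 * π - Φ)) (abs_le.2 ⟨by linarith [pb'.1, qb'.1],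
    by linarith [pb'.2, qb'.2]⟩) (by positivity) (by linarith) (by
      rw [← flip _ _ b₂]
      congr 1
      ring : _ = Real.cos (π / 3))
  have e₃ := abs_eq_of_cos_eq (x := ξ' Φ + ξq (2 * π - Φ)) (abs_le.2 ⟨by linarith [mb'.1, qb'.1],
    by linarith [mb'.2, qb'.2]⟩) (by positivity) (by linarith) (by
      rw [← flip _ _ b₃]
      congr 1
      ring : _ = Real.cos (π / 3))
  refine PolarTheta.false (ρp := ρ) (ξp := ξ) (ρm := ρ') (ξm := ξ') (ρq := ρq) (ξq := ξq) (Φ := Φ)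
    ⟨p.pos, by linarith [q.pos], p.arc, m.arc, q.arc, left_m, right_m, left_q, right_q, inside,
      by linarith, by linarith, ?_, ?_⟩
  · rcases abs_cases (ξ 0 + ξq 0) with h1 | h1 <;> rcases abs_cases (ξ' 0 + ξq 0) with h2 | h2 <;>
      linarith
  · rcases abs_cases (ξ Φ + ξq (2 * π - Φ)) with h1 | h1 <;>
      rcases abs_cases (ξ' Φ + ξq (2 * π - Φ)) with h2 | h2 <;> linarith

/-- Two of the arcs cannot run counterclockwise and the third one clockwise. -/
theorem not_pos_pos_neg (h : ComplexTheta z T L A B) {i j l : Fin 3} (hij : i ≠ j) (hil : i ≠ l)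
    (hjl : j ≠ l) (hi : 0 < (conj A * T i 0).im) (hj : 0 < (conj A * T j 0).im)
    (hl : (conj A * T l 0).im < 0) : False := by
  obtain ⟨ρ, ξ, σ, Φ, p⟩ := (h.arc i).exists_polarForm (by rwa [h.left])
  obtain ⟨ρ', ξ', σ', Φ', p'⟩ := (h.arc j).exists_polarForm (by rwa [h.left])
  obtain ⟨ρq, ξq, σq, Φq, q⟩ := (h.arc l).conjugate.exists_polarForm (by
    rw [← map_mul, conj_im, h.left]
    linarith)
  -- Both counterclockwise arcs complement the same clockwise arc, so they are graphs over one
  -- interval. They do not cross in its interior, so one lies inside the other.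
  have e₁ := h.add_eq_two_pi hil p q
  have e₂ := h.add_eq_two_pi hjl p' q
  obtain rfl : Φ' = Φ := by linarith
  obtain rfl : Φq = 2 * π - Φ' := by linarith
  have hne : ∀ t ∈ Ioo 0 Φ', ρ t - ρ' t ≠ 0 := fun t ht =>
    sub_ne_zero.2 (h.ne_of_mem_Ioo hij p p' ht)
  have hcont : ContinuousOn (fun t => ρ t - ρ' t) (Ioo 0 Φ') :=
    (p.arc.contRho.sub p'.arc.contRho).mono Ioo_subset_Icc_self
  have hm : Φ' / 2 ∈ Ioo 0 Φ' := ⟨by linarith [p.pos], by linarith [p.pos]⟩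
  rcases lt_or_gt_of_ne (hne _ hm) with h0 | h0
  · refine h.false_of_inside hij.symm hjl hil p' p q fun t ht => ?_
    by_contra! hcon
    obtain ⟨x, hx, hx0⟩ := isPreconnected_Ioo.intermediate_value hm ht hcont
      (⟨h0.le, by linarith⟩ : (0 : ℝ) ∈ Icc (ρ (Φ' / 2) - ρ' (Φ' / 2)) (ρ t - ρ' t))
    exact hne x hx hx0
  · refine h.false_of_inside hij hil hjl p p' q fun t ht => ?_
    by_contra! hcon
    obtain ⟨x, hx, hx0⟩ := isPreconnected_Ioo.intermediate_value ht hm hcont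
      (⟨by linarith, h0.le⟩ : (0 : ℝ) ∈ Icc (ρ t - ρ' t) (ρ (Φ' / 2) - ρ' (Φ' / 2)))
    exact hne x hx hx0

theorem not_neg_neg_pos (h : ComplexTheta z T L A B) {i j l : Fin 3} (hij : i ≠ j) (hil : i ≠ l)
    (hjl : j ≠ l) (hi : (conj A * T i 0).im < 0) (hj : (conj A * T j 0).im < 0)
    (hl : 0 < (conj A * T l 0).im) : False := by
  refine h.conjugate.not_pos_pos_neg hij hil hjl ?_ ?_ ?_ <;> rw [← map_mul, conj_im] <;> linarith

/-- One arc cannot lie on a line through the origin, with the two others on both sides of it. -/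
theorem not_pos_neg_zero (h : ComplexTheta z T L A B) {i j l : Fin 3} (hij : i ≠ j) (hil : i ≠ l)
    (hi : 0 < (conj A * T i 0).im) (hj : (conj A * T j 0).im < 0)
    (hl : (conj A * T l 0).im = 0) : False := by
  obtain ⟨ρ, ξ, σ, Φ, p⟩ := (h.arc i).exists_polarForm (by rwa [h.left])
  obtain ⟨ρq, ξq, σq, Φq, q⟩ := (h.arc j).conjugate.exists_polarForm (by
    rw [← map_mul, conj_im, h.left]
    linarith)
  have hsum := h.add_eq_two_pi hij p q
  have hpi := Real.pi_pos
  have hL := (h.arc l).pos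
  have l₁ := left_mem_Icc.2 p.pos.le
  have r₁ := right_mem_Icc.2 p.pos.le
  have curv : ∀ s ∈ Icc 0 (L l), (conj (z l s) * T l s).im = 0 := fun s hs => by
    rw [(h.arc l).curvature_eq hs, h.left, hl, zero_mul]
  have hT : ∀ s ∈ Icc 0 (L l), T l s = T l 0 := by
    have d : ∀ s ∈ Icc 0 (L l), HasDerivWithinAt (T l) 0 (Icc 0 (L l)) s := fun s hs =>
      ((h.arc l).deriv_tangent s hs).congr_deriv (by rw [curv s hs]; simp)
    exact constant_of_derivWithin_zero (fun s hs => (d s hs).differentiableWithinAt)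
      fun s hs => (d s (Ico_subset_Icc_self hs)).derivWithin
        (uniqueDiffOn_Icc hL s (Ico_subset_Icc_self hs))
  have hB : B = A + L l * T l 0 := by
    have d : ∀ s ∈ Icc 0 (L l), HasDerivWithinAt (fun s : ℝ => z l s - s * T l 0) 0 (Icc 0 (L l)) s :=
      fun s hs => by
        refine (((h.arc l).deriv_point s hs).sub
          ((hasDerivWithinAt_id s _).ofReal_comp.mul_const (T l 0))).congr_deriv ?_
        rw [hT s hs]
        simp
    have := constant_of_derivWithin_zero (fun s hs => (d s hs).differentiableWithinAt)
      (fun s hs => (d s (Ico_subset_Icc_self hs)).derivWithin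
        (uniqueDiffOn_Icc hL s (Ico_subset_Icc_self hs))) _ (right_mem_Icc.2 hL.le)
    rw [h.left, h.right, ofReal_zero, zero_mul, sub_zero] at this
    linear_combination this
  have hA : A ≠ 0 := by
    have := p.ne_zero
    rwa [h.left] at this
  have hr : (‖A‖ : ℂ) ≠ 0 := ofReal_ne_zero.2 (norm_ne_zero_iff.2 hA)
  have hr' : 0 < ‖A‖ := norm_pos_iff.2 hA
  have he := p.norm_div_norm
  rw [h.left] at he
  have heA : A = ‖A‖ * (A / ‖A‖) := by field_simp
  have hTl : T l 0 = ((conj A * T l 0).re / ‖A‖ : ℝ) * (A / ‖A‖) := by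
    have h1 : conj A * T l 0 = (conj A * T l 0).re := by
      apply Complex.ext <;> simp [hl]
    have h2 : A * (conj A * T l 0) = ‖A‖ ^ 2 * T l 0 := by
      rw [← mul_assoc, mul_conj, normSq_eq_norm_sq]
      push_cast
      ring
    rw [h1] at h2
    generalize (conj A * T l 0).re = m at h2 ⊢
    push_cast
    field_simp
    linear_combination -h2
  have pB := p.point _ r₁
  have t₀ := p.tangent _ l₁
  have t₁ := p.tangent _ r₁
  rw [p.right, h.right, h.left] at pB
  rw [p.left, h.left, ← ofReal_sub] at t₀
  rw [p.right, h.left, ← ofReal_sub] at t₁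
  have nT := (h.arc l).norm_tangent 0 (left_mem_Icc.2 hL.le)
  have a₁ := h.angle_left i l hil
  have a₂ := h.angle_right i l hil
  rw [hT _ (right_mem_Icc.2 hL.le)] at a₂
  generalize (conj A * T l 0).re / ‖A‖ = c at hTl
  generalize A / (‖A‖ : ℂ) = e at *
  have he0 : e ≠ 0 := norm_ne_zero_iff.1 (by rw [he]; exact one_ne_zero)
  have hc : |c| = 1 := by
    rw [hTl, norm_mul, he, mul_one, norm_real] at nT
    exact nT
  have hend : exp (ρ Φ + Φ * I) = (‖A‖ + L l * c : ℝ) := by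
    refine mul_right_cancel₀ he0 ?_
    rw [← pB, hB, hTl]
    push_cast
    linear_combination heA
  have him := congrArg Complex.im hend
  have hre := congrArg Complex.re hend
  rw [Complex.exp_im] at him
  rw [Complex.exp_re] at hre
  simp only [add_re, ofReal_re, mul_re, I_re, mul_zero, ofReal_im, I_im, mul_one, sub_self, add_zero,
    add_im, mul_im, zero_add, mul_eq_zero, (Real.exp_pos _).ne', false_or] at him hre
  -- `B` lies on the line through `0` and `A`, and `0 < Φ < 2π`. Then `B` is opposite to `A`, and
  -- the straight arc runs through the origin with tangent `-e`.
  have hΦ : Φ = π := by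
    have h1 : Real.sin (Φ - π) = 0 := by rw [Real.sin_sub_pi, him, neg_zero]
    linarith [(Real.sin_eq_zero_iff_of_lt_of_lt (by linarith [p.pos]) (by linarith [q.pos])).1 h1]
  rw [hΦ, Real.cos_pi] at hre
  have hc' : c = -1 := by
    rcases abs_cases c with h1 | h1
    · have : 0 ≤ L l * c := mul_nonneg hL.le h1.2
      linarith [Real.exp_pos (ρ π)]
    · linarith
  have hTl' : T l 0 = I * exp ((π / 2 : ℝ) * I) * e := by
    rw [hTl, hc']
    push_cast
    rw [exp_pi_div_two_mul_I, I_mul_I]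
  rw [t₀, hTl', re_tangent_mul_conj he,
    show 0 - ξ 0 - π / 2 = -(ξ 0 + π / 2) by ring, Real.cos_neg, Real.cos_add_pi_div_two] at a₁
  rw [t₁, hTl', re_tangent_mul_conj he, hΦ,
    show π - ξ π - π / 2 = π / 2 - ξ π by ring, Real.cos_pi_div_two_sub] at a₂
  subst hΦ
  refine p.arc.not_line ?_ ?_
  · exact Real.injOn_sin (Ioo_subset_Icc_self (p.arc.bound _ l₁)) ⟨by linarith, by linarith⟩ (by
      rw [Real.sin_pi_div_six]
      linarith)
  · exact Real.injOn_sin (Ioo_subset_Icc_self (p.arc.bound _ r₁)) ⟨by linarith, by linarith⟩ (by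
      rw [Real.sin_neg, Real.sin_pi_div_six]
      linarith)

end ComplexTheta

/-- Two directions that are not parallel cannot both be radial at `w ≠ 0`. -/
theorem eq_zero_of_im_eq_zero {w a b : ℂ} (ha : ‖a‖ = 1) (hb : ‖b‖ = 1)
    (hab : (a * conj b).re = -1 / 2) (ha' : (conj w * a).im = 0) (hb' : (conj w * b).im = 0) :
    w = 0 := by
  have h1 : (normSq w : ℂ) * (a * conj b) = conj w * a * conj (conj w * b) := by
    rw [← mul_conj, map_mul, Complex.conj_conj]
    ring
  have h2 := congrArg Complex.im h1
  rw [im_ofReal_mul, mul_im (conj w * a), conj_im, ha', hb', neg_zero, mul_zero, zero_mul, add_zero] at h2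
  rcases mul_eq_zero.1 h2 with h3 | h3
  · exact normSq_eq_zero.1 h3
  · have h4 : normSq (a * conj b) = 1 := by
      rw [normSq_eq_norm_sq, norm_mul, RCLike.norm_conj, ha, hb]
      norm_num
    rw [normSq_apply, h3, hab] at h4
    norm_num at h4

theorem add_add_eq_zero {a b c : ℂ} (ha : ‖a‖ = 1) (hb : ‖b‖ = 1) (hc : ‖c‖ = 1)
    (hab : (a * conj b).re = -1 / 2) (hac : (a * conj c).re = -1 / 2)
    (hbc : (b * conj c).re = -1 / 2) : a + b + c = 0 := by
  rw [← normSq_eq_zero, normSq_add, normSq_add, add_mul, add_re, hab, hac, hbc, normSq_eq_norm_sq,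
    normSq_eq_norm_sq, normSq_eq_norm_sq, ha, hb, hc]
  norm_num

namespace ComplexTheta

variable {z T : Fin 3 → ℝ → ℂ} {L : Fin 3 → ℝ} {A B : ℂ}

theorem false (h : ComplexTheta z T L A B) : False := by
  have n := fun i => (h.arc i).norm_tangent 0 (left_mem_Icc.2 (h.arc i).pos.le)
  have n' := fun i => (h.arc i).norm_tangent _ (right_mem_Icc.2 (h.arc i).pos.le)
  have h01 : (0 : Fin 3) ≠ 1 := by decide
  have h02 : (0 : Fin 3) ≠ 2 := by decide
  have h12 : (1 : Fin 3) ≠ 2 := by decide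
  -- The tangents at `A` sum to zero, which leaves the patterns `+ + -`, `- - +`, `+ - 0` in any
  -- order, and `0 0 0`. Only the last survives the case split; it puts both `A` and `B` at the
  -- origin.
  have hsum : (conj A * T 0 0).im + (conj A * T 1 0).im + (conj A * T 2 0).im = 0 := by
    rw [← add_im, ← add_im, ← mul_add, ← mul_add, add_add_eq_zero (n 0) (n 1) (n 2)
      (h.angle_left _ _ h01) (h.angle_left _ _ h02) (h.angle_left _ _ h12), mul_zero, zero_im]
  rcases lt_trichotomy (conj A * T 0 0).im 0 with h0 | h0 | h0 <;>
    rcases lt_trichotomy (conj A * T 1 0).im 0 with h1 | h1 | h1 <;>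
    rcases lt_trichotomy (conj A * T 2 0).im 0 with h2 | h2 | h2 <;>
    first
    | linarith
    | exact h.not_pos_pos_neg h01 h02 h12 h0 h1 h2
    | exact h.not_pos_pos_neg h02 h01 h12.symm h0 h2 h1
    | exact h.not_pos_pos_neg h12 h01.symm h02.symm h1 h2 h0
    | exact h.not_neg_neg_pos h01 h02 h12 h0 h1 h2
    | exact h.not_neg_neg_pos h02 h01 h12.symm h0 h2 h1
    | exact h.not_neg_neg_pos h12 h01.symm h02.symm h1 h2 h0
    | exact h.not_pos_neg_zero h01 h02 h0 h1 h2
    | exact h.not_pos_neg_zero h01.symm h12 h1 h0 h2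
    | exact h.not_pos_neg_zero h02 h01 h0 h2 h1
    | exact h.not_pos_neg_zero h02.symm h12.symm h2 h0 h1
    | exact h.not_pos_neg_zero h12 h01.symm h1 h2 h0
    | exact h.not_pos_neg_zero h12.symm h02.symm h2 h1 h0
    | skip
  have hA := eq_zero_of_im_eq_zero (n 0) (n 1) (h.angle_left _ _ h01) h0 h1
  have curv : ∀ i, (conj A * T i 0).im = 0 → (conj B * T i (L i)).im = 0 := fun i hi => by
    have := (h.arc i).curvature_eq (right_mem_Icc.2 (h.arc i).pos.le)
    rwa [h.left, h.right, hi, zero_mul] at this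
  have hB := eq_zero_of_im_eq_zero (n' 0) (n' 1) (h.angle_right _ _ h01) (curv 0 h0) (curv 1 h1)
  have := (h.arc 0).injOn (left_mem_Icc.2 (h.arc 0).pos.le) (right_mem_Icc.2 (h.arc 0).pos.le)
    (by rw [h.left, h.right, hA, hB])
  exact (h.arc 0).pos.ne this

end ComplexTheta

/-! ### Transfer from the Euclidean plane to `ℂ`. -/

/-- The identification of the plane with the complex numbers. -/
noncomputable def toComplex : Plane ≃ₗᵢ[ℝ] ℂ := Complex.orthonormalBasisOneI.repr.symm

theorem toComplex_rot90 (v : Plane) : toComplex (rot90 v) = I * toComplex v := by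
  simp only [toComplex, Complex.orthonormalBasisOneI_repr_symm_apply, rot90]
  simp
  linear_combination -(v 1 : ℂ) * I_sq

theorem inner_toComplex (v w : Plane) : inner ℝ v w = (conj (toComplex v) * toComplex w).re := by
  rw [← toComplex.inner_map_map, Complex.inner, mul_comm]

theorem inner_toComplex_rot90 (v w : Plane) :
    inner ℝ v (rot90 w) = -(conj (toComplex v) * toComplex w).im := by
  rw [inner_toComplex, toComplex_rot90, mul_left_comm, I_mul_re]

theorem IsShrinkingArc.complexArc {γ : ℝ → Plane} {L : ℝ} (h : IsShrinkingArc γ L) :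
    ComplexArc (fun s => toComplex (γ s)) (fun s => toComplex (tangent γ L s)) L where
  pos := h.length_pos
  deriv_point s hs := toComplex.toContinuousLinearEquiv.hasFDerivAt.comp_hasDerivWithinAt s
    ((h.contDiffOn.differentiableOn (by norm_num)) s hs).hasDerivWithinAt
  deriv_tangent s hs := by
    have hd : DifferentiableOn ℝ (tangent γ L) (Icc 0 L) :=
      (h.contDiffOn.derivWithin (m := 1) (uniqueDiffOn_Icc h.length_pos)
        (by norm_num)).differentiableOn (by norm_num)
    have h1 : HasDerivWithinAt (tangent γ L) (curvatureVector γ L s) (Icc 0 L) s :=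
      (hd s hs).hasDerivWithinAt
    have hn : ‖toComplex (tangent γ L s)‖ = 1 := by
      rw [toComplex.norm_map, h.arclength s hs]
    -- Unit speed makes the curvature vector normal, so its normal component, given by the shrinker
    -- equation, determines it.
    have h2 : inner ℝ (tangent γ L s) (curvatureVector γ L s) = 0 := by
      have d1 := h1.norm_sq
      have d2 : HasDerivWithinAt (fun s => ‖tangent γ L s‖ ^ 2) 0 (Icc 0 L) s :=
        (hasDerivWithinAt_const s _ (1 : ℝ)).congr (fun t ht => by rw [h.arclength t ht, one_pow])
          (by rw [h.arclength s hs, one_pow])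
      linarith [(uniqueDiffOn_Icc h.length_pos s hs).eq_deriv _ d1 d2]
    have h3 := h.shrinker s hs
    rw [curvature, normal, inner_toComplex_rot90, inner_toComplex_rot90] at h3
    rw [inner_toComplex] at h2
    refine (toComplex.toContinuousLinearEquiv.hasFDerivAt.comp_hasDerivWithinAt s h1).congr_deriv ?_
    change toComplex (curvatureVector γ L s) = _
    have hnn : conj (toComplex (tangent γ L s)) * toComplex (tangent γ L s) = 1 := by
      rw [Complex.conj_mul', hn]
      norm_num
    generalize toComplex (tangent γ L s) = t at *
    generalize toComplex (curvatureVector γ L s) = c at *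
    have h4 : conj t * c = I * (conj (toComplex (γ s)) * t).im := by
      have h5 : (conj t * c).im = -(conj c * t).im := by
        rw [← conj_im]
        simp [mul_comm]
      apply Complex.ext
      · rw [h2]
        simp
      · rw [h5]
        simp only [mul_im, I_re, I_im, ofReal_re, ofReal_im] at h3 ⊢
        linarith
    linear_combination t * h4 - c * hnn
  norm_tangent s hs := by rw [toComplex.norm_map, h.arclength s hs]
  injOn s hs t ht hst := h.injOn hs ht (toComplex.injective hst)

theorem re_toComplex_mul_conj {v w : Plane} (hv : ‖v‖ = 1) (hw : ‖w‖ = 1)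
    (h : InnerProductGeometry.angle v w = 2 * Real.pi / 3) :
    (toComplex v * conj (toComplex w)).re = -1 / 2 := by
  rw [mul_comm, ← inner_toComplex, real_inner_comm, ← cos_two_pi_div_three, ← h,
    InnerProductGeometry.cos_angle, hv, hw, mul_one, div_one]

theorem IsRegularThetaTriple.complexTheta {γ : Fin 3 → ℝ → Plane} {L : Fin 3 → ℝ} {A B : Plane}
    (h : IsRegularThetaTriple γ L A B) :
    ComplexTheta (fun i s => toComplex (γ i s)) (fun i s => toComplex (tangent (γ i) (L i) s)) L
      (toComplex A) (toComplex B) where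
  arc i := (h.arc i).complexArc
  left i := by rw [h.left_end]
  right i := by rw [h.right_end]
  inter i j hij s hs t ht hst := by
    have h1 : γ i s ∈ γ i '' Icc 0 (L i) ∩ γ j '' Icc 0 (L j) :=
      ⟨mem_image_of_mem _ hs, by rw [toComplex.injective hst]; exact mem_image_of_mem _ ht⟩
    rw [h.inter i j hij] at h1
    exact h1.imp (congrArg _) (congrArg _)
  angle_left i j hij := re_toComplex_mul_conj
    ((h.arc i).arclength _ (left_mem_Icc.2 (h.arc i).length_pos.le))
    ((h.arc j).arclength _ (left_mem_Icc.2 (h.arc j).length_pos.le)) (h.angle_left i j hij)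
  angle_right i j hij := re_toComplex_mul_conj
    ((h.arc i).arclength _ (right_mem_Icc.2 (h.arc i).length_pos.le))
    ((h.arc j).arclength _ (right_mem_Icc.2 (h.arc j).length_pos.le)) (h.angle_right i j hij)

end ThetaShrinker

theorem theorem1p1 : ¬ ∃ N : Set ThetaShrinker.Plane, ThetaShrinker.IsRegularThetaShrinker N := by
  rintro ⟨N, A, B, L, γ, h, -⟩
  exact h.complexTheta.false
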